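/- Setting. Let $N\ge 1$, let $x_0<\dots<x_N$ be the Gauss–Lobatto nodes on $[-1,1]$ ($\pm1$ and the zeros of $L_N'$, $L_N$ the Legendre polynomial), $w_j=\frac{2}{N(N+1)}L_N(x_j)^{-2}$ the quadrature weights, $\ell_n$ the Lagrange polynomials and $D_{jn}=\ell_n'(x_j)$. On the reference cube use the tensor-product nodes; $(\cdot,\cdot)_N$ and $\int_{\partial E,N}$ denote Gauss–Lobatto quadrature on the cube and on its faces, and $\vec\nabla_\xi$ acts on nodal values through $D$. A mesh consists of finitely many hexahedral elements with nodal Jacobians $J>0$ and nodal volume-weighted contravariant vectors $J\vec a^{\,d}$, $d=1,2,3$, satisfying the discrete metric identities $\sum_d \partial_{\xi^d}\mathbb I^N(J\vec a^{\,d})=\vec 0$ at all nodes. On a face $\xi^d=\pm1$ put $\hat s=|J\vec a^{\,d}|$ and $\vec n=\pm J\vec a^{\,d}/\hat s$. Every element face is either a physical boundary face or is identified node by node with exactly one other element face (an interior face, with sides $L$ and $R$; periodically identified faces count as interior), and there $\hat s_L=\hat s_R$, $\vec n:=\vec n_L=-\vec n_R$. Write $[[a]]=a_R-a_L$, $\{\{a\}\}=\frac12(a_L+a_R)$.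 Let $\gamma>1$, $\mathrm{Pr},\mathrm M_\infty,\mathrm{Re}>0$ and let the viscosity satisfy $\mu>0$. For states $u=(\rho,\rho\vec v,\rho E)$ with $\rho,p>0$, where $p=(\gamma-1)(\rho E-\frac12\rho|\vec v|^2)$, let $f_i$ be the Euler fluxes, $s=-\rho(\ln p-\gamma\ln\rho)/(\gamma-1)$ the entropy, $\vec f^{S}=s\vec v$ the entropy flux, $w=\partial s/\partial u$ the entropy variables, and $f^v_i$ the compressible Navier–Stokes viscous fluxes (with $\tau_{ij}=\mu(\partial_i v_j+\partial_j v_i)-\frac23\mu\,(\nabla\cdot\vec v)\,\delta_{ij}$, conductivity $\mu/((\gamma-1)\mathrm{Pr}\,\mathrm M_\infty^2)$, $T=\gamma\mathrm M_\infty^2p/\rho$), written as functions of $u$ and of the gradient of $w$ by the chain rule. Let $F^{ec}=(F^{ec}_1,F^{ec}_2,F^{ec}_3)$ be a two-point flux that is symmetric, consistent ($F_i^{ec}(u,u)=f_i(u)$) and satisfies Tadmor's condition $[[w]]^TF^{ec}_i(u_L,u_R)=[[w^Tf_i-f^S_i]]$ for $i=1,2,3$ and all $u_L,u_R$ with positive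 density and pressure. Scheme. On $[0,T]$, $T>0$, let the nodal values $U(t)$, differentiable in time and with $\rho,p>0$, and $Q(t)$ satisfy on every element, for all polynomial test functions $\varphi$ and $\vartheta$ of degree at most $N$ in each direction, $$(JU_t,\varphi)_N+(\mathbb D\cdot\tilde F^{ec},\varphi)_N+\int_{\partial E,N}\varphi^T\{F_n^*-F_n\}\hat s\,dS=\tfrac1{\mathrm{Re}}(\mathbb D^s\cdot\tilde F^v,\varphi)_N+\tfrac1{\mathrm{Re}}\int_{\partial E,N}\varphi^T\{F_n^{v,*}-F_n^v\}\hat s\,dS,$$ $$(JQ,\vartheta)_N=\int_{\partial E,N}W^{*,T}(\vartheta\cdot\vec n)\hat s\,dS-(W,\vec\nabla_\xi\cdot\mathbb I^N(\mathcal M^T\vartheta))_N .$$ Here $W=w(U)$, $F_i=f_i(U)$, $F^v=f^v(U,Q)$, $\vec F^S=\vec f^S(U)$; the subscript $n$ denotes the component along the outward normal; $(\mathcal M^T\vartheta)^d=\sum_i (Ja^d)_i\vartheta_i$, $\mathbb D^s\cdot\tilde F^v=\vec\nabla_\xi\cdot\mathbb I^N(\mathcal M^TF^v)$; and at each node $I$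 $$(\mathbb D\cdot\tilde F^{ec})_I=\sum_{d=1}^3 2\sum_{m=0}^N D_{I_dm}\,F^{ec}(U_I,U_{I[d\to m]})\cdot\tfrac12\left(J\vec a^{\,d}_I+J\vec a^{\,d}_{I[d\to m]}\right),$$ where $I[d\to m]$ is $I$ with its $d$-th index replaced by $m$. On interior faces $F_n^*=F^{ec}(U_L,U_R)\cdot\vec n-\frac{\lambda_{\max}}2[[W]]$ with some $\lambda_{\max}\ge0$ at each face node, and $W^*=\{\{W\}\}$, $F_n^{v,*}=\{\{F^v\}\}\cdot\vec n$ (BR1); on boundary faces $F_n^*,W^*,F_n^{v,*}$ are arbitrary prescribed values. Claim. The total discrete entropy $\overline S(t)=\sum_{\text{elements}}(J\,s(U(t)),1)_N$ is differentiable on $[0,T]$ and, for all $t\in[0,T]$, $$\frac{d}{dt}\overline S\le \mathrm{PBT}-\sum_{\text{interior faces}}\int_N\frac{\lambda_{\max}}2[[W]]^T[[W]]\,\hat s\,dS,$$ $$\mathrm{PBT}=\sum_{\text{boundary faces}}\int_N\Big\{-\vec F^S\cdot\vec n+\tfrac1{\mathrm{Re}}W^TF^v_n-W^T(F_n^*-F_n)+\tfrac1{\mathrm{Re}}\big[(W^*-W)^TF^v_n+W^T(F_n^{v,*}-F^v_n)\big]\Big\}\hat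 s\,dS .$$ In particular, if at time $t$ the boundary flux is $F_n^*=F^{ec}(U,U_{ext})\cdot\vec n-\frac{\lambda_{\max}}2[[W]]$ with exterior states $U_{ext}$ and $[[W]]=w(U_{ext})-W$, the term $-W^T(F_n^*-F_n)$ equals $-W^T(F^{ec}(U,U_{ext})\cdot\vec n-F_n)+\frac{\lambda_{\max}}2W^T[[W]]$. If $\mathrm{PBT}\le0$ for all $t\in[0,T]$, or if there are no physical boundary faces (periodic boundary conditions), then $\frac{d}{dt}\overline S\le0$ on $[0,T]$ and $\overline S(T)\le\overline S(0)$. -/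

import Mathlib

noncomputable section

namespace DGSEM

/-! ### One-dimensional spectral calculus -/

/-- Legendre polynomials, by the three-term recurrence
`L_{k+2} = (2k+3)/(k+2) x L_{k+1} - (k+1)/(k+2) L_k`. -/
def legendre : ℕ → Polynomial ℝ
  | 0 => 1
  | 1 => Polynomial.X
  | k + 2 =>
      Polynomial.C ((2 * (k : ℝ) + 3) / ((k : ℝ) + 2)) * Polynomial.X * legendre (k + 1)
        - Polynomial.C (((k : ℝ) + 1) / ((k : ℝ) + 2)) * legendre k

/-- `x 0 < x 1 < ... < x N` are the Gauss-Lobatto nodes: `-1`, `1` and the zeros of `L_N'`. -/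
structure IsGaussLobatto (N : ℕ) (x : Fin (N + 1) → ℝ) : Prop where
  strictMono : StrictMono x
  range_iff : ∀ y : ℝ, (∃ j, x j = y) ↔
    y = -1 ∨ y = 1 ∨ (Polynomial.derivative (legendre N)).eval y = 0

variable {N : ℕ}

/-- Gauss-Lobatto quadrature weights. -/
def weight (x : Fin (N + 1) → ℝ) (j : Fin (N + 1)) : ℝ :=
  2 / ((N : ℝ) * ((N : ℝ) + 1)) * (1 / ((legendre N).eval (x j)) ^ 2)

/-- The derivative matrix `D_{jn} = ℓ_n'(x_j)` of the Lagrange basis on the nodes `x`. -/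
def derivMatrix (x : Fin (N + 1) → ℝ) (j n : Fin (N + 1)) : ℝ :=
  (Polynomial.derivative (Lagrange.basis Finset.univ x n)).eval (x j)

/-! ### Tensor-product nodes on the reference cube and on its faces -/

/-- Multi-index `(i, j, k)` of a Gauss-Lobatto node of the reference element `[-1,1]^3`.
A polynomial of degree at most `N` in each direction is represented by its nodal values. -/
abbrev Node (N : ℕ) := Fin 3 → Fin (N + 1)

/-- Index of a node on a face of the cube. -/
abbrev FaceNode (N : ℕ) := Fin 2 → Fin (N + 1)

/-- A face of the reference cube: the coordinate direction `dir` and the side,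
`ξ^dir = 1` if `upper` and `ξ^dir = -1` otherwise. -/
structure LocalFace where
  dir : Fin 3
  upper : Bool
deriving DecidableEq, Fintype

/-- The volume node that sits at a face node. -/
def LocalFace.node (φ : LocalFace) (q : FaceNode N) : Node N :=
  φ.dir.insertNth (α := fun _ => Fin (N + 1)) (if φ.upper then Fin.last N else 0) q

/-- Sign of the outward reference normal. -/
def LocalFace.sign (φ : LocalFace) : ℝ := if φ.upper then 1 else -1

/-- Tensor-product volume weights `w_i w_j w_k`. -/
def volWeight (x : Fin (N + 1) → ℝ) (I : Node N) : ℝ := ∏ d, weight x (I d)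

/-- Tensor-product surface weights. -/
def surfWeight (x : Fin (N + 1) → ℝ) (q : FaceNode N) : ℝ := ∏ e, weight x (q e)

/-- Spectral partial derivative in the reference direction `d`, at the node `I`. -/
def pderiv (x : Fin (N + 1) → ℝ) (d : Fin 3) (f : Node N → ℝ) (I : Node N) : ℝ :=
  ∑ m, derivMatrix x (I d) m * f (Function.update I d m)

/-! ### States, fluxes and entropy of the compressible Navier-Stokes equations -/

/-- State vectors `(ρ, ρ v₁, ρ v₂, ρ v₃, ρ E)`; also entropy variables and fluxes. -/
abbrev State := Fin 5 → ℝ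

/-- Block vectors: one state vector for each Cartesian direction. -/
abbrev BlockVec := Fin 3 → State

/-- Position of the `i`-th momentum (or velocity-like) component in a state vector. -/
def mom (i : Fin 3) : Fin 5 := i.succ.castSucc

/-- Contraction `aᵀ b` of two state vectors. -/
def sdot (a b : State) : ℝ := ∑ c, a c * b c

/-- Dot product `F · n` of a block vector and a space vector, a state vector. -/
def ndot (F : BlockVec) (n : Fin 3 → ℝ) : State := fun c => ∑ i, n i * F i c

/-- Physical parameters: ratio of specific heats, Prandtl, Mach and Reynolds numbers, and the
(possibly state-dependent) viscosity. -/
structure Gas where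
  γ : ℝ
  prandtl : ℝ
  mach : ℝ
  reynolds : ℝ
  μ : State → ℝ

def velocity (u : State) (i : Fin 3) : ℝ := u (mom i) / u 0

/-- `|v|²`. -/
def speedSq (u : State) : ℝ := ∑ i, velocity u i ^ 2

/-- Pressure of an ideal gas, from `ρ E = p / (γ - 1) + ρ |v|² / 2`. -/
def pressure (g : Gas) (u : State) : ℝ := (g.γ - 1) * (u 4 - u 0 * speedSq u / 2)

/-- Positive density and pressure. -/
def Admissible (g : Gas) (u : State) : Prop := 0 < u 0 ∧ 0 < pressure g u

/-- The range of the physical parameters. -/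
structure Gas.Valid (g : Gas) : Prop where
  one_lt_γ : 1 < g.γ
  prandtl_pos : 0 < g.prandtl
  mach_pos : 0 < g.mach
  reynolds_pos : 0 < g.reynolds
  μ_pos : ∀ u, Admissible g u → 0 < g.μ u

/-- Specific total enthalpy `H = E + p / ρ`. -/
def enthalpy (g : Gas) (u : State) : ℝ := u 4 / u 0 + pressure g u / u 0

/-- The advective (Euler) fluxes `f₁, f₂, f₃`. -/
def advFlux (g : Gas) (u : State) : BlockVec := fun i =>
  ![u 0 * velocity u i,
    u 0 * velocity u i * velocity u 0 + (if i = 0 then pressure g u else 0),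
    u 0 * velocity u i * velocity u 1 + (if i = 1 then pressure g u else 0),
    u 0 * velocity u i * velocity u 2 + (if i = 2 then pressure g u else 0),
    u 0 * velocity u i * enthalpy g u]

/-- Physical entropy `ς = ln p - γ ln ρ`. -/
def physEntropy (g : Gas) (u : State) : ℝ := Real.log (pressure g u) - g.γ * Real.log (u 0)

/-- Mathematical entropy `s = - ρ ς / (γ - 1)`. -/
def entropy (g : Gas) (u : State) : ℝ := -(u 0 * physEntropy g u) / (g.γ - 1)

/-- Entropy flux `s v`. -/
def entropyFlux (g : Gas) (u : State) (i : Fin 3) : ℝ := entropy g u * velocity u i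

/-- Entropy variables `w = ∂s/∂u`. -/
def entropyVars (g : Gas) (u : State) : State :=
  ![(g.γ - physEntropy g u) / (g.γ - 1) - u 0 * speedSq u / (2 * pressure g u),
    u 0 * velocity u 0 / pressure g u,
    u 0 * velocity u 1 / pressure g u,
    u 0 * velocity u 2 / pressure g u,
    -u 0 / pressure g u]

/-- Velocity gradient `∂v_j/∂x_i` belonging to the gradient `Q` of the entropy variables, i.e. the
quotient rule applied to `v_j = - w_{1+j} / w_5`. -/
def velGrad (g : Gas) (u : State) (Q : BlockVec) (i j : Fin 3) : ℝ :=
  -(Q i (mom j) * entropyVars g u 4 - entropyVars g u (mom j) * Q i 4) / entropyVars g u 4 ^ 2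

/-- Temperature gradient `∂T/∂x_i` belonging to the gradient `Q` of the entropy variables, i.e. the
quotient rule applied to `T = γ M² p / ρ = - γ M² / w_5`. -/
def tempGrad (g : Gas) (u : State) (Q : BlockVec) (i : Fin 3) : ℝ :=
  g.γ * g.mach ^ 2 * Q i 4 / entropyVars g u 4 ^ 2

/-- Viscous stress tensor. -/
def stress (g : Gas) (u : State) (Q : BlockVec) (i j : Fin 3) : ℝ :=
  g.μ u * (velGrad g u Q i j + velGrad g u Q j i)
    - 2 / 3 * g.μ u * (if i = j then ∑ l, velGrad g u Q l l else 0)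

/-- Heat conductivity `λ = μ / ((γ - 1) Pr M²)`. -/
def conductivity (g : Gas) (u : State) : ℝ :=
  g.μ u / ((g.γ - 1) * g.prandtl * g.mach ^ 2)

/-- The viscous fluxes, as functions of the state and of the gradient of the entropy variables. -/
def viscFlux (g : Gas) (u : State) (Q : BlockVec) : BlockVec := fun i =>
  ![0, stress g u Q i 0, stress g u Q i 1, stress g u Q i 2,
    (∑ j, velocity u j * stress g u Q i j) + conductivity g u * tempGrad g u Q i]

/-- A two-point flux in each Cartesian direction, symmetric, consistent with the advective flux and
entropy conservative: `[[w]]ᵀ f^ec(u_L, u_R) = [[wᵀ f - f^S]]` with `[[a]] = a_R - a_L`. -/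
structure IsEntropyConservative (g : Gas) (Fec : State → State → BlockVec) : Prop where
  symm : ∀ uL uR, Admissible g uL → Admissible g uR → Fec uL uR = Fec uR uL
  consistent : ∀ u, Admissible g u → Fec u u = advFlux g u
  tadmor : ∀ uL uR, Admissible g uL → Admissible g uR → ∀ i,
    sdot (entropyVars g uR - entropyVars g uL) (Fec uL uR i) =
      (sdot (entropyVars g uR) (advFlux g uR i) - entropyFlux g uR i)
        - (sdot (entropyVars g uL) (advFlux g uL i) - entropyFlux g uL i)

/-! ### Curvilinear meshes -/

/-- A symmetry of the square: exchange of the two coordinates and reflections. It describes how the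
nodes of the two sides of an interface are identified. -/
structure SquareSymm where
  perm : Equiv.Perm (Fin 2)
  flip : Fin 2 → Bool

/-- Action of a symmetry of the square on face nodes (Gauss-Lobatto nodes are symmetric about 0, so
a reflection reverses the index). -/
def SquareSymm.act (σ : SquareSymm) : FaceNode N ≃ FaceNode N :=
  (σ.perm.arrowCongr (Equiv.refl (Fin (N + 1)))).trans
    (Equiv.piCongrRight fun e => if σ.flip e then Fin.revPerm else Equiv.refl (Fin (N + 1)))

/-- A mesh of curved hexahedra with elements `K`, interior faces `Fi` (for a periodic
problem these include the identified periodic faces) and physical boundary faces `Fb`.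
Each of the six faces of each element is the left side of an interior face, the right side of an
interior face, or a boundary face, and it is exactly one of these. -/
structure Mesh (N : ℕ) (K Fi Fb : Type*) where
  faces : (Fi ⊕ Fi) ⊕ Fb ≃ K × LocalFace
  /-- node identification, from the left side to the right side of an interior face -/
  glue : Fi → SquareSymm
  /-- nodal values of the Jacobian of the element mapping -/
  J : K → Node N → ℝ
  /-- nodal values of the volume-weighted contravariant vectors: `Ja k I d n` is the Cartesian
  component `n` of `J a^d` -/
  Ja : K → Node N → Fin 3 → Fin 3 → ℝ

variable {K Fi Fb : Type*}

namespace Mesh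

/-- Surface element `ŝ = |J a^d|` at a face node. -/
def surfElem (m : Mesh N K Fi Fb) (kf : K × LocalFace) (q : FaceNode N) : ℝ :=
  Real.sqrt (∑ n, m.Ja kf.1 (kf.2.node q) kf.2.dir n ^ 2)

/-- Outward unit normal `± J a^d / |J a^d|` in physical space at a face node. -/
def normal (m : Mesh N K Fi Fb) (kf : K × LocalFace) (q : FaceNode N) : Fin 3 → ℝ :=
  fun n => kf.2.sign * m.Ja kf.1 (kf.2.node q) kf.2.dir n / m.surfElem kf q

def left (m : Mesh N K Fi Fb) (f : Fi) : K × LocalFace := m.faces (.inl (.inl f))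

def right (m : Mesh N K Fi Fb) (f : Fi) : K × LocalFace := m.faces (.inl (.inr f))

def bdry (m : Mesh N K Fi Fb) (b : Fb) : K × LocalFace := m.faces (.inr b)

/-- What lies on the other side of an element face at a face node: either an interior face, the
index of the point in the numbering of its left side, and the element and node on the other side;
or a physical boundary face. -/
def across (m : Mesh N K Fi Fb) (kf : K × LocalFace) (q : FaceNode N) :
    (Fi × FaceNode N × K × Node N) ⊕ Fb :=
  match m.faces.symm kf with
  | .inl (.inl f) =>
      .inl (f, q, (m.right f).1, (m.right f).2.node ((m.glue f).act q))
  | .inl (.inr f) =>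
      .inl (f, (m.glue f).act.symm q, (m.left f).1, (m.left f).2.node ((m.glue f).act.symm q))
  | .inr b => .inr b

/-- The normal at an interface only changes sign between the two sides, and the surface elements
agree. -/
def Conforming (m : Mesh N K Fi Fb) : Prop :=
  ∀ f q, m.surfElem (m.right f) ((m.glue f).act q) = m.surfElem (m.left f) q ∧
    m.normal (m.right f) ((m.glue f).act q) = -m.normal (m.left f) q

/-- Discrete metric identities: `∑_d ∂_{ξ^d} I^N(J a^d) = 0` at the nodes, in each Cartesian
component. -/
def MetricIdentities (m : Mesh N K Fi Fb) (x : Fin (N + 1) → ℝ) : Prop :=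
  ∀ k I n, ∑ d, pderiv x d (fun I' => m.Ja k I' d n) I = 0

/-- Contravariant block vector `Mᵀ F` in the element `k`. -/
def contra (m : Mesh N K Fi Fb) (k : K) (F : Node N → BlockVec) (I : Node N) : BlockVec :=
  fun d c => ∑ n, m.Ja k I d n * F I n c

/-- Standard spectral divergence `∇_ξ · I^N(Mᵀ F)` in the element `k`. -/
def stdDiv (m : Mesh N K Fi Fb) (x : Fin (N + 1) → ℝ) (k : K) (F : Node N → BlockVec)
    (I : Node N) : State :=
  fun c => ∑ d, pderiv x d (fun I' => m.contra k F I' d c) I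

/-- Split-form (flux differencing) divergence with a two-point volume flux. -/
def splitDiv (m : Mesh N K Fi Fb) (x : Fin (N + 1) → ℝ) (Fec : State → State → BlockVec)
    (k : K) (U : Node N → State) (I : Node N) : State :=
  fun c => ∑ d, 2 * ∑ j, derivMatrix x (I d) j *
    ∑ n, Fec (U I) (U (Function.update I d j)) n c *
      ((m.Ja k I d n + m.Ja k (Function.update I d j) d n) / 2)

end Mesh

/-- Discrete inner product on the reference element. -/
def ipN (x : Fin (N + 1) → ℝ) (F G : Node N → State) : ℝ :=
  ∑ I, volWeight x I * sdot (F I) (G I)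

/-- Surface quadrature `∫_{f,N} G ŝ dS` over one element face. -/
def faceInt (m : Mesh N K Fi Fb) (x : Fin (N + 1) → ℝ) (kf : K × LocalFace)
    (G : FaceNode N → ℝ) : ℝ :=
  ∑ q, surfWeight x q * G q * m.surfElem kf q

/-- Surface quadrature `∫_{∂E,N} G ŝ dS` over the boundary of the element `k`. -/
def surfInt (m : Mesh N K Fi Fb) (x : Fin (N + 1) → ℝ) (k : K)
    (G : LocalFace → FaceNode N → ℝ) : ℝ :=
  ∑ φ, faceInt m x (k, φ) (G φ)

/-! ### Numerical fluxes -/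

/-- Advective surface flux `F^ec(u_in, u_out) · n - (λ_max / 2) [[W]]`, where `n` points from the
inner to the outer state. -/
def surfaceFlux (g : Gas) (Fec : State → State → BlockVec) (lam : ℝ) (n : Fin 3 → ℝ)
    (uin uout : State) : State :=
  ndot (Fec uin uout) n - (lam / 2) • (entropyVars g uout - entropyVars g uin)

/-- Values of the numerical fluxes `F*_n`, `W*` and `F^{v,*}_n` at the physical boundary (with
respect to the outward normal), through which boundary conditions are imposed. -/
structure BoundaryData (N : ℕ) (Fb : Type*) where
  Fstar : Fb → FaceNode N → State
  Wstar : Fb → FaceNode N → State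
  Fvstar : Fb → FaceNode N → State

/-- Everything that determines the spatial discretization at one instant: `lam` is the estimate of
the fastest wave speed at the points of the interior faces. -/
structure Snapshot (N : ℕ) (K Fi Fb : Type*) where
  U : K → Node N → State
  Q : K → Node N → BlockVec
  lam : Fi → FaceNode N → ℝ
  bd : BoundaryData N Fb

namespace Snapshot

/-- Entropy variables at the nodes. -/
def W (z : Snapshot N K Fi Fb) (g : Gas) (k : K) (I : Node N) : State :=
  entropyVars g (z.U k I)

/-- Viscous fluxes at the nodes. -/
def Fv (z : Snapshot N K Fi Fb) (g : Gas) (k : K) (I : Node N) : BlockVec :=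
  viscFlux g (z.U k I) (z.Q k I)

/-- Trace of `U` on an element face. -/
def Utr (z : Snapshot N K Fi Fb) (kf : K × LocalFace) (q : FaceNode N) : State :=
  z.U kf.1 (kf.2.node q)

/-- Trace of `W` on an element face. -/
def Wtr (z : Snapshot N K Fi Fb) (g : Gas) (kf : K × LocalFace) (q : FaceNode N) : State :=
  z.W g kf.1 (kf.2.node q)

/-- Normal advective flux from the interior of the element. -/
def Fn (z : Snapshot N K Fi Fb) (g : Gas) (m : Mesh N K Fi Fb) (kf : K × LocalFace)
    (q : FaceNode N) : State :=
  ndot (advFlux g (z.Utr kf q)) (m.normal kf q)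

/-- Normal viscous flux from the interior of the element. -/
def Fvn (z : Snapshot N K Fi Fb) (g : Gas) (m : Mesh N K Fi Fb) (kf : K × LocalFace)
    (q : FaceNode N) : State :=
  ndot (z.Fv g kf.1 (kf.2.node q)) (m.normal kf q)

/-- Normal entropy flux from the interior of the element. -/
def entFluxN (z : Snapshot N K Fi Fb) (g : Gas) (m : Mesh N K Fi Fb) (kf : K × LocalFace)
    (q : FaceNode N) : ℝ :=
  ∑ i, entropyFlux g (z.Utr kf q) i * m.normal kf q i

/-- Advective numerical flux `F*_n` on an element face, with respect to its outward normal. -/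
def numF (z : Snapshot N K Fi Fb) (g : Gas) (Fec : State → State → BlockVec)
    (m : Mesh N K Fi Fb) (kf : K × LocalFace) (q : FaceNode N) : State :=
  match m.across kf q with
  | .inl (f, r, k', I') =>
      surfaceFlux g Fec (z.lam f r) (m.normal kf q) (z.Utr kf q) (z.U k' I')
  | .inr b => z.bd.Fstar b q

/-- `W* = {{W}}` (BR1) on interior faces. -/
def numW (z : Snapshot N K Fi Fb) (g : Gas) (m : Mesh N K Fi Fb) (kf : K × LocalFace)
    (q : FaceNode N) : State :=
  match m.across kf q with
  | .inl (_, _, k', I') => (1 / 2 : ℝ) • (z.Wtr g kf q + z.W g k' I')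
  | .inr b => z.bd.Wstar b q

/-- `F^{v,*}_n = {{F^v}} · n` (BR1) on interior faces. -/
def numFv (z : Snapshot N K Fi Fb) (g : Gas) (m : Mesh N K Fi Fb) (kf : K × LocalFace)
    (q : FaceNode N) : State :=
  match m.across kf q with
  | .inl (_, _, k', I') =>
      ndot ((1 / 2 : ℝ) • (z.Fv g kf.1 (kf.2.node q) + z.Fv g k' I')) (m.normal kf q)
  | .inr b => z.bd.Fvstar b q

/-- First equation of the split-form DGSEM in the element `k`, tested with `φ`;
`Ut` is the time derivative of `U` in that element. -/
def SplitEq (z : Snapshot N K Fi Fb) (g : Gas) (Fec : State → State → BlockVec)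
    (m : Mesh N K Fi Fb) (x : Fin (N + 1) → ℝ) (k : K) (Ut φ : Node N → State) : Prop :=
  ipN x (fun I => m.J k I • Ut I) φ
      + ipN x (m.splitDiv x Fec k (z.U k)) φ
      + surfInt m x k (fun s q =>
          sdot (φ (s.node q)) (z.numF g Fec m (k, s) q - z.Fn g m (k, s) q))
    = 1 / g.reynolds * ipN x (m.stdDiv x k (z.Fv g k)) φ
      + 1 / g.reynolds * surfInt m x k (fun s q =>
          sdot (φ (s.node q)) (z.numFv g m (k, s) q - z.Fvn g m (k, s) q))

/-- Second equation of the split-form DGSEM (for the auxiliary gradient of the entropy variables) in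
the element `k`, tested with the block vector `θ`. -/
def GradEq (z : Snapshot N K Fi Fb) (g : Gas) (m : Mesh N K Fi Fb) (x : Fin (N + 1) → ℝ)
    (k : K) (θ : Node N → BlockVec) : Prop :=
  ∑ I, volWeight x I * ∑ i, sdot (m.J k I • z.Q k I i) (θ I i)
    = surfInt m x k (fun s q =>
        sdot (z.numW g m (k, s) q) (ndot (θ (s.node q)) (m.normal (k, s) q)))
      - ipN x (z.W g k) (m.stdDiv x k θ)

/-- Total discrete entropy `∑_k (J^k S^k, 1)_N`. -/
def totalEntropy [Fintype K] (z : Snapshot N K Fi Fb) (g : Gas) (m : Mesh N K Fi Fb)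
    (x : Fin (N + 1) → ℝ) : ℝ :=
  ∑ k, ∑ I, volWeight x I * (m.J k I * entropy g (z.U k I))

/-- Jump `[[W]] = W_R - W_L` at a point of an interior face. -/
def jumpW (z : Snapshot N K Fi Fb) (g : Gas) (m : Mesh N K Fi Fb) (f : Fi) (q : FaceNode N) :
    State :=
  z.Wtr g (m.right f) ((m.glue f).act q) - z.Wtr g (m.left f) q

/-- Interface dissipation `∑_{interior faces} ∫_N (λ_max / 2) [[W]]ᵀ [[W]] ŝ dS`. -/
def interfaceDissipation [Fintype Fi] (z : Snapshot N K Fi Fb) (g : Gas) (m : Mesh N K Fi Fb)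
    (x : Fin (N + 1) → ℝ) : ℝ :=
  ∑ f, faceInt m x (m.left f) (fun q => z.lam f q / 2 * sdot (z.jumpW g m f q) (z.jumpW g m f q))

/-- Physical boundary terms: those of the continuous entropy estimate,
`- F^S · n + (1/Re) Wᵀ (F^v · n)`, plus the contributions
`- Wᵀ (F*_n - F_n) + (1/Re) ((W* - W)ᵀ F^v_n + Wᵀ (F^{v,*}_n - F^v_n))` of the numerical
boundary fluxes. -/
def boundaryTerms [Fintype Fb] (z : Snapshot N K Fi Fb) (g : Gas) (m : Mesh N K Fi Fb)
    (x : Fin (N + 1) → ℝ) : ℝ :=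
  ∑ b, faceInt m x (m.bdry b) (fun q =>
    - z.entFluxN g m (m.bdry b) q
      + 1 / g.reynolds * sdot (z.Wtr g (m.bdry b) q) (z.Fvn g m (m.bdry b) q)
      - sdot (z.Wtr g (m.bdry b) q) (z.bd.Fstar b q - z.Fn g m (m.bdry b) q)
      + 1 / g.reynolds *
        (sdot (z.bd.Wstar b q - z.Wtr g (m.bdry b) q) (z.Fvn g m (m.bdry b) q)
          + sdot (z.Wtr g (m.bdry b) q) (z.bd.Fvstar b q - z.Fvn g m (m.bdry b) q)))

/-- The physical boundary terms when the advective boundary flux is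
`F*_n = F^ec(U, U_ext) · n - (λ_max / 2) [[W]]` with exterior states `U_ext`, written out. -/
def boundaryTermsExt [Fintype Fb] (z : Snapshot N K Fi Fb) (g : Gas)
    (Fec : State → State → BlockVec) (m : Mesh N K Fi Fb) (x : Fin (N + 1) → ℝ)
    (lamB : Fb → FaceNode N → ℝ) (Uext : Fb → FaceNode N → State) : ℝ :=
  ∑ b, faceInt m x (m.bdry b) (fun q =>
    - z.entFluxN g m (m.bdry b) q
      + 1 / g.reynolds * sdot (z.Wtr g (m.bdry b) q) (z.Fvn g m (m.bdry b) q)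
      - sdot (z.Wtr g (m.bdry b) q)
          (ndot (Fec (z.Utr (m.bdry b) q) (Uext b q)) (m.normal (m.bdry b) q)
            - z.Fn g m (m.bdry b) q)
      + lamB b q / 2 * sdot (z.Wtr g (m.bdry b) q)
          (entropyVars g (Uext b q) - z.Wtr g (m.bdry b) q)
      + 1 / g.reynolds *
        (sdot (z.bd.Wstar b q - z.Wtr g (m.bdry b) q) (z.Fvn g m (m.bdry b) q)
          + sdot (z.Wtr g (m.bdry b) q) (z.bd.Fvstar b q - z.Fvn g m (m.bdry b) q)))

end Snapshot

/-- `z` is a semi-discrete solution on `[0, T]` of the split-form DGSEM: the nodal states have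
positive density and pressure and are differentiable in time, and both equations of the scheme hold
in each element, for all test functions. -/
structure IsSolution (g : Gas) (Fec : State → State → BlockVec) (m : Mesh N K Fi Fb)
    (x : Fin (N + 1) → ℝ) (T : ℝ) (z : ℝ → Snapshot N K Fi Fb) : Prop where
  admissible : ∀ t ∈ Set.Icc 0 T, ∀ k I, Admissible g ((z t).U k I)
  lam_nonneg : ∀ t ∈ Set.Icc 0 T, ∀ f q, 0 ≤ (z t).lam f q
  split_eq : ∀ t ∈ Set.Icc 0 T, ∃ Ut : K → Node N → State,
    (∀ k I, HasDerivWithinAt (fun τ => (z τ).U k I) (Ut k I) (Set.Icc 0 T) t) ∧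
      ∀ k φ, (z t).SplitEq g Fec m x k (Ut k) φ
  grad_eq : ∀ t ∈ Set.Icc 0 T, ∀ k θ, (z t).GradEq g m x k θ

end DGSEM

end

/-!
The Legendre equation `d/dX ((X ^ 2 - 1) dL_N/dX) = N (N + 1) L_N` says that the derivative of the
nodal polynomial of the Gauss-Lobatto points is a multiple of `L_N`. This determines the entries of
the derivative matrix `D` in terms of the values `L_N (x_j)`, which also define the quadrature
weights, and gives the summation-by-parts property of `D`.

Contract the advective volume term with the entropy variables. Tadmor's condition says that a
contracted two-point flux minus the potential `ψ = wᵀ f - f^S` at its first argument is symmetric,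
and summation by parts reduces a symmetric two-point quantity to its boundary values. The remaining
volume terms multiply `ψ` by the discrete metric identities and vanish, so that only the entropy
flux through the element faces is left. The gradient equation, tested with the viscous flux, turns
the viscous volume term into face terms minus `(J Q, F^v)_N`, which is nonnegative: it is the square
of the traceless symmetric velocity gradient plus the square of the temperature gradient, with
nonnegative coefficients.

On an interface the two outward normals are opposite. By Tadmor's condition the advective face terms
of the two sides add up to `-λ/2 |[[W]]|²`, and by the product rule for jumps the
central viscous traces cancel.
-/

namespace DGSEM

section Polynomials

open Polynomial

/-! ### Legendre polynomials -/

lemma legendre_add_two (n : ℕ) :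
    ((n : ℝ[X]) + 2) * legendre (n + 2)
      = (2 * (n : ℝ[X]) + 3) * X * legendre (n + 1) - ((n : ℝ[X]) + 1) * legendre n := by
  refine Polynomial.funext fun y => ?_
  have h : (n : ℝ) + 2 ≠ 0 := by positivity
  simp only [legendre, eval_mul, eval_add, eval_sub, eval_natCast, eval_ofNat, eval_one, eval_C,
    eval_X]
  field_simp

lemma derivative_legendre_add_two (n : ℕ) :
    ((n : ℝ[X]) + 2) * derivative (legendre (n + 2))
      = (2 * (n : ℝ[X]) + 3) * (legendre (n + 1) + X * derivative (legendre (n + 1)))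
        - ((n : ℝ[X]) + 1) * derivative (legendre n) := by
  have h := congrArg derivative (legendre_add_two n)
  simp only [derivative_mul, derivative_add, derivative_sub, derivative_natCast, derivative_ofNat,
    derivative_one, derivative_X] at h
  linear_combination h

lemma derivative_legendre_succ_and_succ_mul_legendre_succ (n : ℕ) :
    derivative (legendre (n + 1))
        = X * derivative (legendre n) + ((n : ℝ[X]) + 1) * legendre n ∧
      ((n : ℝ[X]) + 1) * legendre (n + 1)
        = (X ^ 2 - 1) * derivative (legendre n) + ((n : ℝ[X]) + 1) * X * legendre n := by
  induction n with
  | zero => simp [legendre]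
  | succ n ih =>
    obtain ⟨hderiv, hval⟩ := ih
    have hn : (n : ℝ[X]) + 2 ≠ 0 := by exact_mod_cast (n + 1).succ_ne_zero
    have hderiv' : derivative (legendre (n + 2))
        = X * derivative (legendre (n + 1)) + ((n : ℝ[X]) + 2) * legendre (n + 1) := by
      refine mul_left_cancel₀ hn ?_
      linear_combination derivative_legendre_add_two n + ((n : ℝ[X]) + 1) * (X * hderiv - hval)
    push_cast
    constructor
    · linear_combination hderiv'
    · linear_combination legendre_add_two n - (X ^ 2 - 1) * hderiv + X * hval

lemma derivative_legendre_succ (n : ℕ) :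
    derivative (legendre (n + 1)) = X * derivative (legendre n) + ((n : ℝ[X]) + 1) * legendre n :=
  (derivative_legendre_succ_and_succ_mul_legendre_succ n).1

lemma succ_mul_legendre_succ (n : ℕ) :
    ((n : ℝ[X]) + 1) * legendre (n + 1)
      = (X ^ 2 - 1) * derivative (legendre n) + ((n : ℝ[X]) + 1) * X * legendre n :=
  (derivative_legendre_succ_and_succ_mul_legendre_succ n).2

lemma derivative_sq_sub_one_mul_derivative_legendre (n : ℕ) :
    derivative ((X ^ 2 - 1) * derivative (legendre n)) = C (n * (n + 1) : ℝ) * legendre n := by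
  have h : (X ^ 2 - 1) * derivative (legendre n)
      = ((n : ℝ[X]) + 1) * (legendre (n + 1) - X * legendre n) := by
    linear_combination -succ_mul_legendre_succ n
  rw [h]
  simp only [derivative_mul, derivative_add, derivative_sub, derivative_natCast, derivative_one,
    derivative_X, derivative_legendre_succ, C_mul, C_add, C_1, map_natCast]
  ring

lemma natDegree_legendre_le (n : ℕ) : (legendre n).natDegree ≤ n := by
  induction n using Nat.twoStepInduction with
  | zero => simp [legendre]
  | one => simp [legendre]
  | more n ih₀ ih₁ =>
    have hX : (C ((2 * (n : ℝ) + 3) / (n + 2)) * X).natDegree ≤ 1 := by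
      compute_degree
    refine (natDegree_sub_le _ _).trans (max_le ?_ ?_)
    · exact (natDegree_mul_le_of_le hX ih₁).trans_eq (by ring)
    · exact (natDegree_C_mul_le _ _).trans (ih₀.trans (by omega))

lemma legendre_comp_neg_X (n : ℕ) :
    (legendre n).comp (-X) = (-1) ^ n * legendre n := by
  induction n using Nat.twoStepInduction with
  | zero => simp [legendre]
  | one => simp [legendre]
  | more n ih₀ ih₁ =>
    simp only [legendre, sub_comp, mul_comp, C_comp, X_comp, ih₀, ih₁]
    ring

lemma derivative_legendre_comp_neg_X (n : ℕ) :
    (derivative (legendre n)).comp (-X) = (-1) ^ (n + 1) * derivative (legendre n) := by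
  have h := congrArg derivative (legendre_comp_neg_X n)
  rw [derivative_comp] at h
  have hsign : derivative ((-1 : ℝ[X]) ^ n) = 0 := by
    simp
  simp only [derivative_neg, derivative_X, derivative_mul, hsign, zero_mul, zero_add] at h
  linear_combination -h

lemma eval_neg_legendre (n : ℕ) (y : ℝ) :
    (legendre n).eval (-y) = (-1) ^ n * (legendre n).eval y := by
  simpa [eval_comp] using congrArg (eval y) (legendre_comp_neg_X n)

lemma eval_neg_derivative_legendre (n : ℕ) (y : ℝ) :
    (derivative (legendre n)).eval (-y) = (-1) ^ (n + 1) * (derivative (legendre n)).eval y := by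
  simpa [eval_comp] using congrArg (eval y) (derivative_legendre_comp_neg_X n)

lemma eval_one_legendre (n : ℕ) : (legendre n).eval 1 = 1 := by
  induction n with
  | zero => simp [legendre]
  | succ n ih =>
    have h := congrArg (eval 1) (succ_mul_legendre_succ n)
    have hn : (n + 1 : ℝ) ≠ 0 := by positivity
    simpa [ih, hn] using h

lemma eval_legendre_sq_eq_one (n : ℕ) {y : ℝ} (hy : y ^ 2 = 1) : (legendre n).eval y ^ 2 = 1 := by
  rcases sq_eq_one_iff.1 hy with rfl | rfl
  · rw [eval_one_legendre, one_pow]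
  · rw [eval_neg_legendre, eval_one_legendre, mul_one, ← pow_mul, mul_comm, pow_mul, neg_one_sq,
      one_pow]

lemma two_mul_eval_derivative_legendre (n : ℕ) {y : ℝ} (hy : y ^ 2 = 1) :
    2 * y * (derivative (legendre n)).eval y = n * (n + 1) * (legendre n).eval y := by
  have h := congrArg (eval y) (derivative_sq_sub_one_mul_derivative_legendre n)
  simpa [hy, one_add_one_eq_two] using h

lemma eval_legendre_pos_and_derivative_nonneg (n : ℕ) {y : ℝ} (hy : 1 ≤ y) :
    0 < (legendre n).eval y ∧ 0 ≤ (derivative (legendre n)).eval y := by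
  induction n with
  | zero => simp [legendre]
  | succ n ih =>
    obtain ⟨hpos, hderiv⟩ := ih
    have h := congrArg (eval y) (succ_mul_legendre_succ n)
    simp only [eval_mul, eval_add, eval_sub, eval_pow, eval_natCast, eval_one, eval_X] at h
    have hsq : 0 ≤ y ^ 2 - 1 := sub_nonneg.2 (one_le_pow₀ hy)
    constructor
    · refine pos_of_mul_pos_right (a := (n + 1 : ℝ)) ?_ (by positivity)
      rw [h]
      positivity
    · rw [derivative_legendre_succ]
      simp only [eval_mul, eval_add, eval_natCast, eval_one, eval_X]
      positivity

lemma eval_derivative_legendre_pos {n : ℕ} (hn : n ≠ 0) {y : ℝ} (hy : 1 ≤ y) :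
    0 < (derivative (legendre n)).eval y := by
  obtain ⟨k, rfl⟩ := Nat.exists_eq_succ_of_ne_zero hn
  obtain ⟨hpos, hderiv⟩ := eval_legendre_pos_and_derivative_nonneg k hy
  rw [derivative_legendre_succ]
  simp only [eval_mul, eval_add, eval_natCast, eval_one, eval_X]
  positivity

lemma abs_lt_one_of_eval_derivative_legendre_eq_zero {n : ℕ} (hn : n ≠ 0) {y : ℝ}
    (hy : (derivative (legendre n)).eval y = 0) : |y| < 1 := by
  by_contra! h
  rcases le_abs'.1 h with h | h
  · have := eval_derivative_legendre_pos hn (le_neg.2 h)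
    rw [eval_neg_derivative_legendre, hy, mul_zero] at this
    exact this.false
  · exact (eval_derivative_legendre_pos hn h).ne' hy

/-! ### Summation by parts at the Gauss-Lobatto nodes -/

section DerivMatrix

variable {N : ℕ} {x : Fin (N + 1) → ℝ}

lemma eval_derivative_nodal_ne_zero (hx : Function.Injective x) (n : Fin (N + 1)) :
    (derivative (Lagrange.nodal Finset.univ x)).eval (x n) ≠ 0 := by
  have h := Lagrange.nodalWeight_ne_zero hx.injOn (Finset.mem_univ n)
  rw [Lagrange.nodalWeight_eq_eval_derivative_nodal (Finset.mem_univ n)] at h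
  exact fun h₀ => h (inv_eq_zero.2 h₀)

lemma C_mul_basis_mul_X_sub_C_eq_nodal (hx : Function.Injective x) (n : Fin (N + 1)) :
    C ((derivative (Lagrange.nodal Finset.univ x)).eval (x n))
        * (Lagrange.basis Finset.univ x n * (X - C (x n)))
      = Lagrange.nodal Finset.univ x := by
  have hw : C ((derivative (Lagrange.nodal Finset.univ x)).eval (x n))
      * C (Lagrange.nodalWeight Finset.univ x n) = (1 : ℝ[X]) := by
    rw [Lagrange.nodalWeight_eq_eval_derivative_nodal (Finset.mem_univ n), ← C_mul,
      mul_inv_cancel₀ (eval_derivative_nodal_ne_zero hx n), C_1]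
  rw [Lagrange.basis_eq_prod_sub_inv_mul_nodal_div (Finset.mem_univ n),
    ← Lagrange.nodal_erase_eq_nodal_div (Finset.mem_univ n), mul_assoc, ← mul_assoc, hw, one_mul,
    mul_comm, ← Lagrange.nodal_eq_mul_nodal_erase (Finset.mem_univ n)]

lemma derivMatrix_mul_sub (hx : Function.Injective x) {j n : Fin (N + 1)} (h : j ≠ n) :
    (derivative (Lagrange.nodal Finset.univ x)).eval (x n) * (derivMatrix x j n * (x j - x n))
      = (derivative (Lagrange.nodal Finset.univ x)).eval (x j) := by
  have hbasis := Lagrange.eval_basis_of_ne (v := x) h.symm (Finset.mem_univ j)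
  simpa [hbasis, derivMatrix] using
    congrArg (fun p => (derivative p).eval (x j)) (C_mul_basis_mul_X_sub_C_eq_nodal hx n)

lemma two_mul_derivMatrix_self (hx : Function.Injective x) (n : Fin (N + 1)) :
    (derivative (Lagrange.nodal Finset.univ x)).eval (x n) * (2 * derivMatrix x n n)
      = (derivative (derivative (Lagrange.nodal Finset.univ x))).eval (x n) := by
  have h := congrArg (fun p => (derivative (derivative p)).eval (x n))
    (C_mul_basis_mul_X_sub_C_eq_nodal hx n)
  simpa [derivMatrix, two_mul] using h

lemma sum_derivMatrix (hx : Function.Injective x) (j : Fin (N + 1)) :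
    ∑ n, derivMatrix x j n = 0 := by
  have h := congrArg (fun p => (derivative p).eval (x j))
    (Lagrange.sum_basis (s := Finset.univ) hx.injOn Finset.univ_nonempty)
  simpa [derivative_sum, eval_finsetSum, derivMatrix] using h

end DerivMatrix

/-- Summation by parts for a quadrature rule with weights `w`, a differentiation matrix `D` that is
exact on constants, and boundary quadrature weights `b`: in matrix notation, with
`M = diag w` and `B = diag b`, `D 1 = 0` and `M D + (M D)ᵀ = B`. -/
structure IsSummationByParts {R ι : Type*} [CommRing R] [Fintype ι] [DecidableEq ι]
    (w : ι → R) (D : ι → ι → R) (b : ι → R) : Prop where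
  sum_row : ∀ i, ∑ j, D i j = 0
  mul_add_mul : ∀ i j, w i * D i j + w j * D j i = if i = j then b i else 0

namespace IsSummationByParts

variable {R ι : Type*} [CommRing R] [Fintype ι] [DecidableEq ι] {w : ι → R} {D : ι → ι → R}
  {b : ι → R}

lemma sum_mul_add_swap (h : IsSummationByParts w D b) (p : ι → ι → R) :
    ∑ i, w i * ∑ j, D i j * (p i j + p j i) = ∑ i, b i * p i i := by
  have hswap : ∑ i, ∑ j, w i * D i j * p j i = ∑ i, ∑ j, w j * D j i * p i j :=
    Finset.sum_comm
  calc ∑ i, w i * ∑ j, D i j * (p i j + p j i)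
      = ∑ i, ∑ j, w i * D i j * p i j + ∑ i, ∑ j, w i * D i j * p j i := by
        simp only [Finset.mul_sum, ← Finset.sum_add_distrib, mul_add, mul_assoc]
    _ = ∑ i, ∑ j, (w i * D i j + w j * D j i) * p i j := by
        simp only [hswap, ← Finset.sum_add_distrib, add_mul]
    _ = ∑ i, b i * p i i := by
        simp only [h.mul_add_mul, ite_mul, zero_mul, Finset.sum_ite_eq, Finset.mem_univ, if_true]

/-- Subtracting the potential at the first argument makes the two-point flux symmetric, so only
boundary terms survive summation by parts. -/
lemma sum_fluxDifferencing (h : IsSummationByParts w D b) {F : ι → ι → R} {ψ : ι → R}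
    (hF : ∀ i j, F i j - F j i = ψ i - ψ j) (a : ι → R) :
    ∑ i, w i * ∑ j, D i j * (F i j * (a i + a j))
      = ∑ i, w i * (ψ i * ∑ j, D i j * a j) + ∑ i, b i * ((F i i - ψ i) * a i) := by
  rw [← h.sum_mul_add_swap fun i j => (F i j - ψ i) * a i, ← Finset.sum_add_distrib]
  refine Finset.sum_congr rfl fun i _ => ?_
  have hsplit : ∑ j, D i j * (F i j * (a i + a j))
      = ψ i * a i * ∑ j, D i j + ψ i * ∑ j, D i j * a j
        + ∑ j, D i j * ((F i j - ψ i) * a i + (F j i - ψ j) * a j) := by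
    simp only [Finset.mul_sum, ← Finset.sum_add_distrib]
    exact Finset.sum_congr rfl fun j _ => by linear_combination D i j * a j * hF i j
  rw [hsplit, h.sum_row, mul_zero, zero_add, mul_add]

end IsSummationByParts

section GaussLobatto

variable {N : ℕ} {x : Fin (N + 1) → ℝ}

lemma weight_nonneg (x : Fin (N + 1) → ℝ) (j : Fin (N + 1)) : 0 ≤ weight x j := by
  unfold weight
  positivity

namespace IsGaussLobatto

lemma ne_zero (hx : IsGaussLobatto N x) : N ≠ 0 := by
  rintro rfl
  obtain ⟨i, hi⟩ := (hx.range_iff (-1)).2 (Or.inl rfl)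
  obtain ⟨j, hj⟩ := (hx.range_iff 1).2 (Or.inr (Or.inl rfl))
  rw [Subsingleton.elim (α := Fin 1) i j, hj] at hi
  norm_num at hi

lemma abs_le_one (hx : IsGaussLobatto N x) (j : Fin (N + 1)) : |x j| ≤ 1 := by
  rcases (hx.range_iff (x j)).1 ⟨j, rfl⟩ with h | h | h
  · simp [h]
  · simp [h]
  · exact (abs_lt_one_of_eval_derivative_legendre_eq_zero hx.ne_zero h).le

lemma zero_eq (hx : IsGaussLobatto N x) : x 0 = -1 := by
  obtain ⟨j, hj⟩ := (hx.range_iff (-1)).2 (Or.inl rfl)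
  exact le_antisymm (hj ▸ hx.strictMono.monotone (Fin.zero_le j)) (abs_le.1 (hx.abs_le_one 0)).1

lemma last_eq (hx : IsGaussLobatto N x) : x (Fin.last N) = 1 := by
  obtain ⟨j, hj⟩ := (hx.range_iff 1).2 (Or.inr (Or.inl rfl))
  exact le_antisymm (abs_le.1 (hx.abs_le_one _)).2 (hj ▸ hx.strictMono.monotone (Fin.le_last j))

lemma eval_derivative_legendre_eq_zero (hx : IsGaussLobatto N x) {j : Fin (N + 1)} (h₀ : j ≠ 0)
    (hlast : j ≠ Fin.last N) : (derivative (legendre N)).eval (x j) = 0 := by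
  rcases (hx.range_iff (x j)).1 ⟨j, rfl⟩ with h | h | h
  · exact absurd (hx.strictMono.injective (h.trans hx.zero_eq.symm)) h₀
  · exact absurd (hx.strictMono.injective (h.trans hx.last_eq.symm)) hlast
  · exact h

lemma exists_eq_neg (hx : IsGaussLobatto N x) (j : Fin (N + 1)) : ∃ i, x i = -x j := by
  rw [hx.range_iff]
  rcases (hx.range_iff (x j)).1 ⟨j, rfl⟩ with h | h | h
  · simp [h]
  · simp [h]
  · exact Or.inr (Or.inr (by rw [eval_neg_derivative_legendre, h, mul_zero]))

lemma rev_eq_neg (hx : IsGaussLobatto N x) (j : Fin (N + 1)) : x j.rev = -x j := by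
  have hmono : StrictMono fun j => -x (Fin.rev j) := fun a b h =>
    neg_lt_neg (hx.strictMono (Fin.rev_lt_rev.2 h))
  have hrange : Set.range (fun j => -x (Fin.rev j)) = Set.range x := by
    ext y
    constructor
    · rintro ⟨j, rfl⟩
      exact hx.exists_eq_neg _
    · rintro ⟨j, rfl⟩
      obtain ⟨i, hi⟩ := hx.exists_eq_neg j
      exact ⟨i.rev, by simp [hi]⟩
  exact neg_eq_iff_eq_neg.1 (congrFun ((hmono.range_inj hx.strictMono).1 hrange) j)

lemma weight_rev (hx : IsGaussLobatto N x) (j : Fin (N + 1)) : weight x j.rev = weight x j := by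
  have hsign : ((-1 : ℝ) ^ N) ^ 2 = 1 := by rw [← pow_mul, mul_comm, pow_mul, neg_one_sq, one_pow]
  rw [weight, hx.rev_eq_neg, eval_neg_legendre, mul_pow, hsign, one_mul, weight]

lemma nodal_dvd (hx : IsGaussLobatto N x) :
    Lagrange.nodal Finset.univ x ∣ (X ^ 2 - 1) * derivative (legendre N) := by
  refine Finset.prod_dvd_of_coprime
    (fun i _ j _ hij => pairwise_coprime_X_sub_C hx.strictMono.injective hij) fun i _ => ?_
  rw [dvd_iff_isRoot, IsRoot.def, eval_mul]
  rcases (hx.range_iff (x i)).1 ⟨i, rfl⟩ with h | h | h <;> simp [h]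

lemma exists_derivative_nodal_eq (hx : IsGaussLobatto N x) :
    ∃ c ≠ 0, derivative (Lagrange.nodal Finset.univ x) = C c * legendre N := by
  let q : ℝ[X] := (X ^ 2 - 1) * derivative (legendre N)
  have hdeg : q.natDegree ≤ (Lagrange.nodal Finset.univ x).natDegree := by
    have hsq : (X ^ 2 - 1 : ℝ[X]).natDegree ≤ 2 := by compute_degree
    have hderiv := (natDegree_derivative_le (legendre N)).trans
      (Nat.sub_le_sub_right (natDegree_legendre_le N) 1)
    have hN := hx.ne_zero
    rw [Lagrange.natDegree_nodal, Finset.card_univ, Fintype.card_fin]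
    exact (natDegree_mul_le_of_le hsq hderiv).trans (by omega)
  have hnodal : q = C q.leadingCoeff * Lagrange.nodal Finset.univ x :=
    eq_leadingCoeff_mul_of_monic_of_dvd_of_natDegree_le Lagrange.nodal_monic hx.nodal_dvd hdeg
  have hode : C (N * (N + 1) : ℝ) * legendre N
      = C q.leadingCoeff * derivative (Lagrange.nodal Finset.univ x) := by
    rw [← derivative_C_mul, ← hnodal, derivative_sq_sub_one_mul_derivative_legendre]
  have hlead : q.leadingCoeff ≠ 0 := by
    intro h
    have := congrArg (eval 1) hode
    simp [h, eval_one_legendre, hx.ne_zero, Nat.cast_add_one_ne_zero] at this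
  have hN : (N * (N + 1) : ℝ) ≠ 0 :=
    mul_ne_zero (Nat.cast_ne_zero.2 hx.ne_zero) (Nat.cast_add_one_ne_zero N)
  refine ⟨N * (N + 1) / q.leadingCoeff, div_ne_zero hN hlead, ?_⟩
  refine mul_left_cancel₀ (C_ne_zero.2 hlead) ?_
  rw [← hode, ← mul_assoc, ← C_mul, mul_div_cancel₀ _ hlead]

lemma eval_legendre_ne_zero (hx : IsGaussLobatto N x) (j : Fin (N + 1)) :
    (legendre N).eval (x j) ≠ 0 := by
  obtain ⟨c, -, hc⟩ := hx.exists_derivative_nodal_eq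
  have h := eval_derivative_nodal_ne_zero hx.strictMono.injective j
  rw [hc, eval_C_mul] at h
  exact right_ne_zero_of_mul h

lemma legendre_mul_derivMatrix_mul_sub (hx : IsGaussLobatto N x) {j n : Fin (N + 1)}
    (h : j ≠ n) :
    (legendre N).eval (x n) * (derivMatrix x j n * (x j - x n)) = (legendre N).eval (x j) := by
  obtain ⟨c, hc₀, hc⟩ := hx.exists_derivative_nodal_eq
  have hD := derivMatrix_mul_sub hx.strictMono.injective h
  rw [hc, eval_C_mul, eval_C_mul, mul_assoc] at hD
  exact mul_left_cancel₀ hc₀ hD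

lemma legendre_mul_two_mul_derivMatrix_self (hx : IsGaussLobatto N x) (n : Fin (N + 1)) :
    (legendre N).eval (x n) * (2 * derivMatrix x n n) = (derivative (legendre N)).eval (x n) := by
  obtain ⟨c, hc₀, hc⟩ := hx.exists_derivative_nodal_eq
  have hD := two_mul_derivMatrix_self hx.strictMono.injective n
  rw [hc, derivative_C_mul, eval_C_mul, eval_C_mul, mul_assoc] at hD
  exact mul_left_cancel₀ hc₀ hD

lemma weight_mul_derivMatrix_add_of_ne (hx : IsGaussLobatto N x) {j n : Fin (N + 1)}
    (h : j ≠ n) : weight x j * derivMatrix x j n + weight x n * derivMatrix x n j = 0 := by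
  have hjn := hx.legendre_mul_derivMatrix_mul_sub h
  have hnj := hx.legendre_mul_derivMatrix_mul_sub h.symm
  have hj := hx.eval_legendre_ne_zero j
  have hn := hx.eval_legendre_ne_zero n
  have hN : (N : ℝ) ≠ 0 := Nat.cast_ne_zero.2 hx.ne_zero
  have hsub : x j - x n ≠ 0 := sub_ne_zero.2 (hx.strictMono.injective.ne h)
  have hanti : (legendre N).eval (x n) ^ 2 * derivMatrix x j n
      + (legendre N).eval (x j) ^ 2 * derivMatrix x n j = 0 := by
    refine mul_right_cancel₀ hsub ?_
    linear_combination (legendre N).eval (x n) * hjn - (legendre N).eval (x j) * hnj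
  unfold weight
  field_simp
  linear_combination 2 * hanti

lemma two_mul_weight_mul_derivMatrix_self (hx : IsGaussLobatto N x) {j : Fin (N + 1)}
    (hj : x j ^ 2 = 1) : 2 * (weight x j * derivMatrix x j j) = x j := by
  have hN : (N : ℝ) ≠ 0 := Nat.cast_ne_zero.2 hx.ne_zero
  have hD : 4 * x j * derivMatrix x j j = N * (N + 1) := by
    refine mul_left_cancel₀ (hx.eval_legendre_ne_zero j) ?_
    linear_combination 2 * x j * hx.legendre_mul_two_mul_derivMatrix_self j
      + two_mul_eval_derivative_legendre N hj
  rw [weight, eval_legendre_sq_eq_one N hj]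
  field_simp
  linear_combination x j * hD - 4 * derivMatrix x j j * hj

theorem isSummationByParts (hx : IsGaussLobatto N x) :
    IsSummationByParts (weight x) (derivMatrix x)
      (Pi.single (Fin.last N) 1 - Pi.single 0 1) where
  sum_row := sum_derivMatrix hx.strictMono.injective
  mul_add_mul j n := by
    rcases eq_or_ne j n with rfl | hjn
    · have h₀ : (0 : Fin (N + 1)) ≠ Fin.last N := Fin.ne_of_lt hx.ne_zero.bot_lt
      rw [if_pos rfl, ← two_mul]
      rcases eq_or_ne j (Fin.last N) with rfl | hlast
      · simp [hx.two_mul_weight_mul_derivMatrix_self, hx.last_eq, h₀.symm]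
      rcases eq_or_ne j 0 with rfl | hzero
      · simp [hx.two_mul_weight_mul_derivMatrix_self, hx.zero_eq, h₀]
      have hD : derivMatrix x j j = 0 := by
        simpa [hx.eval_derivative_legendre_eq_zero hzero hlast, hx.eval_legendre_ne_zero] using
          hx.legendre_mul_two_mul_derivMatrix_self j
      simp [hD, hzero, hlast]
    · rw [if_neg hjn, hx.weight_mul_derivMatrix_add_of_ne hjn]

end IsGaussLobatto

end GaussLobatto

end Polynomials

open Matrix

/-! ### Flux differencing in an element -/

section Cube

variable {N : ℕ} (x : Fin (N + 1) → ℝ)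

lemma volWeight_nonneg (I : Node N) : 0 ≤ volWeight x I :=
  Finset.prod_nonneg fun _ _ => weight_nonneg x _

lemma surfWeight_nonneg (q : FaceNode N) : 0 ≤ surfWeight x q :=
  Finset.prod_nonneg fun _ _ => weight_nonneg x _

lemma volWeight_insertNth (d : Fin 3) (i : Fin (N + 1)) (q : FaceNode N) :
    volWeight x (d.insertNth (α := fun _ => Fin (N + 1)) i q) = surfWeight x q * weight x i := by
  rw [volWeight, surfWeight, Fin.prod_univ_succAbove _ d, mul_comm]
  simp

lemma sum_node_eq {M : Type*} [AddCommMonoid M] (d : Fin 3) (f : Node N → M) :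
    ∑ I, f I = ∑ q : FaceNode N, ∑ i, f (d.insertNth (α := fun _ => Fin (N + 1)) i q) := by
  rw [← (Fin.insertNthEquiv (fun _ => Fin (N + 1)) d).sum_comp, Fintype.sum_prod_type,
    Finset.sum_comm]
  rfl

lemma sum_localFace {M : Type*} [AddCommMonoid M] (f : LocalFace → M) :
    ∑ φ, f φ = ∑ d, (f ⟨d, true⟩ + f ⟨d, false⟩) := by
  let e : Fin 3 × Bool ≃ LocalFace :=
    ⟨fun p => ⟨p.1, p.2⟩, fun φ => (φ.dir, φ.upper), fun _ => rfl, fun _ => rfl⟩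
  rw [← e.sum_comp, Fintype.sum_prod_type]
  exact Finset.sum_congr rfl fun d _ => Fintype.sum_bool _

variable {x}

lemma IsGaussLobatto.sum_volWeight_fluxDifferencing (hx : IsGaussLobatto N x) (d : Fin 3)
    {F : Node N → Node N → ℝ} {ψ : Node N → ℝ} (hF : ∀ I I', F I I' - F I' I = ψ I - ψ I')
    (a : Node N → ℝ) :
    ∑ I, volWeight x I * ∑ j, derivMatrix x (I d) j *
        (F I (Function.update I d j) * (a I + a (Function.update I d j)))
      = ∑ I, volWeight x I * (ψ I * pderiv x d a I)
        + ∑ upper, ∑ q, surfWeight x q * ((⟨d, upper⟩ : LocalFace).sign *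
          ((F (LocalFace.node ⟨d, upper⟩ q) (LocalFace.node ⟨d, upper⟩ q)
            - ψ (LocalFace.node ⟨d, upper⟩ q)) * a (LocalFace.node ⟨d, upper⟩ q))) := by
  rw [sum_node_eq d, sum_node_eq d, Finset.sum_comm (s := (Finset.univ : Finset Bool)),
    ← Finset.sum_add_distrib]
  refine Finset.sum_congr rfl fun q _ => ?_
  let line (i : Fin (N + 1)) : Node N := d.insertNth (α := fun _ => Fin (N + 1)) i q
  have hline := hx.isSummationByParts.sum_fluxDifferencing (F := fun i j => F (line i) (line j))
    (ψ := ψ ∘ line) (fun i j => hF (line i) (line j)) (a ∘ line)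
  simp only [Pi.sub_apply, sub_mul, Finset.sum_sub_distrib, Pi.single_apply, ite_mul, one_mul,
    zero_mul, Finset.sum_ite_eq', Finset.mem_univ, if_true, Function.comp_apply] at hline
  simp only [volWeight_insertNth, pderiv, Fin.insertNth_apply_same, Fin.update_insertNth,
    mul_assoc, ← Finset.mul_sum, ← mul_add, Fintype.sum_bool, LocalFace.sign, LocalFace.node,
    if_true, Bool.false_eq_true, if_false, one_mul, neg_one_mul]
  refine congrArg _ (hline.trans ?_)
  simp only [line]
  ring

end Cube

section States

lemma sdot_eq_dotProduct (a b : State) : sdot a b = a ⬝ᵥ b := rfl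

lemma sdot_ndot (a : State) (F : BlockVec) (n : Fin 3 → ℝ) :
    sdot a (ndot F n) = ∑ i, n i * sdot a (F i) := by
  simp only [sdot, ndot, Finset.mul_sum, mul_left_comm (a _)]
  exact Finset.sum_comm

lemma ndot_neg (F : BlockVec) (n : Fin 3 → ℝ) : ndot F (-n) = -ndot F n :=
  neg_vecMul n F

lemma ndot_add (F G : BlockVec) (n : Fin 3 → ℝ) : ndot (F + G) n = ndot F n + ndot G n :=
  vecMul_add F G n

lemma ndot_smul (c : ℝ) (F : BlockVec) (n : Fin 3 → ℝ) : ndot (c • F) n = c • ndot F n :=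
  vecMul_smul n c F

/-- The entropy flux potential `wᵀ f_i - f^S_i`, whose jump appears in Tadmor's condition. -/
noncomputable def entropyPotential (g : Gas) (u : State) (i : Fin 3) : ℝ :=
  sdot (entropyVars g u) (advFlux g u i) - entropyFlux g u i

namespace IsEntropyConservative

variable {g : Gas} {Fec : State → State → BlockVec}

lemma sdot_sub_sdot_swap (hFec : IsEntropyConservative g Fec) {u v : State}
    (hu : Admissible g u) (hv : Admissible g v) (i : Fin 3) :
    sdot (entropyVars g u) (Fec u v i) - sdot (entropyVars g v) (Fec v u i)
      = entropyPotential g u i - entropyPotential g v i := by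
  rw [hFec.symm u v hu hv]
  exact (sub_dotProduct _ _ _).symm.trans (hFec.tadmor v u hv hu i)

lemma sdot_self_sub_entropyPotential (hFec : IsEntropyConservative g Fec) {u : State}
    (hu : Admissible g u) (i : Fin 3) :
    sdot (entropyVars g u) (Fec u u i) - entropyPotential g u i = entropyFlux g u i := by
  rw [hFec.consistent u hu, entropyPotential, sub_sub_cancel]

end IsEntropyConservative

end States

section Element

variable {N : ℕ} {x : Fin (N + 1) → ℝ} {K Fi Fb : Type*} (m : Mesh N K Fi Fb)

lemma Mesh.normal_mul_surfElem (kf : K × LocalFace) (q : FaceNode N) (n : Fin 3) :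
    m.normal kf q n * m.surfElem kf q = kf.2.sign * m.Ja kf.1 (kf.2.node q) kf.2.dir n := by
  refine div_mul_cancel_of_imp fun h => ?_
  have hsum := (Real.sqrt_eq_zero (Finset.sum_nonneg fun _ _ => sq_nonneg _)).1 h
  have hJa := (Finset.sum_eq_zero_iff_of_nonneg fun _ _ => sq_nonneg _).1 hsum n (Finset.mem_univ n)
  rw [pow_eq_zero_iff two_ne_zero |>.1 hJa, mul_zero]

lemma surfInt_sum_mul_normal (x : Fin (N + 1) → ℝ) (k : K)
    (G : LocalFace → FaceNode N → Fin 3 → ℝ) :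
    surfInt m x k (fun φ q => ∑ n, G φ q n * m.normal (k, φ) q n)
      = ∑ d, ∑ n, ∑ upper, ∑ q, surfWeight x q * ((⟨d, upper⟩ : LocalFace).sign *
          (G ⟨d, upper⟩ q n * m.Ja k (LocalFace.node ⟨d, upper⟩ q) d n)) := by
  have hpoint (φ : LocalFace) (q : FaceNode N) :
      surfWeight x q * (∑ n, G φ q n * m.normal (k, φ) q n) * m.surfElem (k, φ) q
        = ∑ n, surfWeight x q * (φ.sign * (G φ q n * m.Ja k (φ.node q) φ.dir n)) := by
    rw [mul_assoc, Finset.sum_mul, Finset.mul_sum]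
    refine Finset.sum_congr rfl fun n _ => ?_
    rw [mul_assoc, m.normal_mul_surfElem, mul_left_comm φ.sign]
  simp only [surfInt, faceInt, hpoint, sum_localFace, Fintype.sum_bool,
    Finset.sum_comm (s := (Finset.univ : Finset (FaceNode N))), ← Finset.sum_add_distrib]

lemma ipN_splitDiv (x : Fin (N + 1) → ℝ) (Fec : State → State → BlockVec) (k : K)
    (U φ : Node N → State) :
    ipN x (m.splitDiv x Fec k U) φ
      = ∑ d, ∑ n, ∑ I, volWeight x I * ∑ j, derivMatrix x (I d) j *
          (sdot (φ I) (Fec (U I) (U (Function.update I d j)) n) *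
            (m.Ja k I d n + m.Ja k (Function.update I d j) d n)) := by
  have hpoint (I : Node N) : sdot (m.splitDiv x Fec k U I) (φ I)
      = ∑ d, ∑ n, ∑ j, derivMatrix x (I d) j *
          (sdot (φ I) (Fec (U I) (U (Function.update I d j)) n) *
            (m.Ja k I d n + m.Ja k (Function.update I d j) d n)) := by
    simp only [sdot, Mesh.splitDiv, Finset.mul_sum, Finset.sum_mul]
    rw [Finset.sum_comm]
    refine Finset.sum_congr rfl fun d _ => ?_
    rw [Finset.sum_comm_cycle]
    refine Finset.sum_congr rfl fun n _ => Finset.sum_comm.trans ?_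
    refine Finset.sum_congr rfl fun j _ => Finset.sum_congr rfl fun c _ => ?_
    ring
  simp only [ipN, hpoint, Finset.mul_sum (_ : Finset (Fin 3)),
    Finset.sum_comm (s := (Finset.univ : Finset (Node N)))]

lemma sum_volWeight_mul_pderiv_Ja (hmetric : m.MetricIdentities x) (k : K)
    (ψ : Node N → Fin 3 → ℝ) :
    ∑ d, ∑ n, ∑ I, volWeight x I * (ψ I n * pderiv x d (fun I' => m.Ja k I' d n) I) = 0 := by
  rw [Finset.sum_comm]
  refine Finset.sum_eq_zero fun n _ => ?_
  rw [Finset.sum_comm]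
  refine Finset.sum_eq_zero fun I _ => ?_
  rw [← Finset.mul_sum, ← Finset.mul_sum, hmetric, mul_zero, mul_zero]

theorem ipN_splitDiv_entropyVars (hx : IsGaussLobatto N x) {m : Mesh N K Fi Fb}
    (hmetric : m.MetricIdentities x) {g : Gas} {Fec : State → State → BlockVec}
    (hFec : IsEntropyConservative g Fec) (k : K) {U : Node N → State}
    (hU : ∀ I, Admissible g (U I)) :
    ipN x (m.splitDiv x Fec k U) (fun I => entropyVars g (U I))
      = surfInt m x k (fun φ q =>
          ∑ n, entropyFlux g (U (φ.node q)) n * m.normal (k, φ) q n) := by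
  have hline (d n : Fin 3) := hx.sum_volWeight_fluxDifferencing d
    (fun I I' => hFec.sdot_sub_sdot_swap (hU I) (hU I') n) (fun I => m.Ja k I d n)
  simp only [hFec.sdot_self_sub_entropyPotential (hU _)] at hline
  simp only [ipN_splitDiv, surfInt_sum_mul_normal, hline, Finset.sum_add_distrib]
  rw [sum_volWeight_mul_pderiv_Ja m hmetric k fun I => entropyPotential g (U I), zero_add]

end Element

/-! ### Entropy variables and viscous dissipation -/

section EntropyVariables

lemma entropyVars_zero (g : Gas) (u : State) :
    entropyVars g u 0
      = (g.γ - physEntropy g u) / (g.γ - 1) - u 0 * speedSq u / (2 * pressure g u) :=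
  rfl

lemma entropyVars_mom (g : Gas) (u : State) (i : Fin 3) :
    entropyVars g u (mom i) = u 0 * velocity u i / pressure g u := by
  fin_cases i <;> rfl

lemma entropyVars_four (g : Gas) (u : State) : entropyVars g u 4 = -u 0 / pressure g u :=
  rfl

lemma sdot_eq_add_sum_mom_add (a b : State) :
    sdot a b = a 0 * b 0 + ∑ i, a (mom i) * b (mom i) + a 4 * b 4 := by
  rw [sdot, Fin.sum_univ_succ, Fin.sum_univ_castSucc, ← add_assoc]
  rfl

variable {g : Gas} {u : ℝ → State} {u' : State} {s : Set ℝ} {t : ℝ}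

lemma hasDerivWithinAt_velocity (hu : HasDerivWithinAt u u' s t) (hρ : u t 0 ≠ 0) (i : Fin 3) :
    HasDerivWithinAt (fun τ => velocity (u τ) i)
      ((u' (mom i) - velocity (u t) i * u' 0) / u t 0) s t := by
  have hcomponent := hasDerivWithinAt_pi.1 hu
  refine ((hcomponent (mom i)).div (hcomponent 0) hρ).congr_deriv ?_
  rw [velocity]
  field_simp

lemma hasDerivWithinAt_speedSq (hu : HasDerivWithinAt u u' s t) (hρ : u t 0 ≠ 0) :
    HasDerivWithinAt (fun τ => speedSq (u τ))
      (2 * (∑ i, velocity (u t) i * u' (mom i) - speedSq (u t) * u' 0) / u t 0) s t := by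
  refine (HasDerivWithinAt.fun_sum fun i (_ : i ∈ Finset.univ) =>
    (hasDerivWithinAt_velocity hu hρ i).fun_pow 2).congr_deriv ?_
  rw [speedSq, Finset.sum_mul, ← Finset.sum_sub_distrib, Finset.mul_sum, Finset.sum_div]
  refine Finset.sum_congr rfl fun i _ => ?_
  ring

lemma hasDerivWithinAt_pressure (g : Gas) (hu : HasDerivWithinAt u u' s t) (hρ : u t 0 ≠ 0) :
    HasDerivWithinAt (fun τ => pressure g (u τ))
      ((g.γ - 1) * (u' 4 - ∑ i, velocity (u t) i * u' (mom i) + u' 0 * speedSq (u t) / 2)) s t := by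
  have hcomponent := hasDerivWithinAt_pi.1 hu
  have hkinetic := ((hcomponent 0).fun_mul (hasDerivWithinAt_speedSq hu hρ)).div_const 2
  refine (((hcomponent 4).sub hkinetic).const_mul (g.γ - 1)).congr_deriv ?_
  field_simp
  ring

theorem hasDerivWithinAt_entropy (hγ : g.γ ≠ 1) (hu : HasDerivWithinAt u u' s t)
    (ha : Admissible g (u t)) :
    HasDerivWithinAt (fun τ => entropy g (u τ)) (sdot (entropyVars g (u t)) u') s t := by
  have hρ := ha.1.ne'
  have hp := ha.2.ne'
  have hγ' := sub_ne_zero.2 hγ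
  have hdensity := hasDerivWithinAt_pi.1 hu 0
  have hphys : HasDerivWithinAt (fun τ => physEntropy g (u τ)) _ s t :=
    ((hasDerivWithinAt_pressure g hu hρ).log hp).sub ((hdensity.log hρ).const_mul g.γ)
  refine ((hdensity.mul hphys).neg.div_const (g.γ - 1)).congr_deriv ?_
  simp only [sdot_eq_add_sum_mom_add, entropyVars_zero, entropyVars_mom, entropyVars_four,
    div_mul_eq_mul_div, ← Finset.sum_div, mul_assoc (u t 0), ← Finset.mul_sum]
  field_simp
  ring

end EntropyVariables

section ViscousFluxes

lemma viscFlux_zero (g : Gas) (u : State) (Q : BlockVec) (i : Fin 3) : viscFlux g u Q i 0 = 0 :=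
  rfl

lemma viscFlux_mom (g : Gas) (u : State) (Q : BlockVec) (i j : Fin 3) :
    viscFlux g u Q i (mom j) = stress g u Q i j := by
  fin_cases j <;> rfl

lemma viscFlux_four (g : Gas) (u : State) (Q : BlockVec) (i : Fin 3) :
    viscFlux g u Q i 4
      = (∑ j, velocity u j * stress g u Q i j) + conductivity g u * tempGrad g u Q i :=
  rfl

lemma sum_velGrad_mul_stress (g : Gas) (u : State) (Q : BlockVec) :
    ∑ i, ∑ j, velGrad g u Q i j * stress g u Q i j
      = g.μ u / 2 * ∑ i, ∑ j, (velGrad g u Q i j + velGrad g u Q j i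
          - if i = j then 2 / 3 * ∑ l, velGrad g u Q l l else 0) ^ 2 := by
  simp only [stress, Fin.sum_univ_three, Fin.isValue, Fin.reduceEq, if_true, if_false]
  ring

variable {g : Gas} {u : State}

lemma sdot_viscFlux (hu : Admissible g u) (Q : BlockVec) (i : Fin 3) :
    sdot (Q i) (viscFlux g u Q i)
      = u 0 / pressure g u * ∑ j, velGrad g u Q i j * stress g u Q i j
        + conductivity g u * (g.γ * g.mach ^ 2) * (Q i 4 / entropyVars g u 4) ^ 2 := by
  have hρ := hu.1.ne'
  have hp := hu.2.ne'
  have hmom (j : Fin 3) :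
      Q i (mom j) = u 0 / pressure g u * velGrad g u Q i j - velocity u j * Q i 4 := by
    rw [velGrad, entropyVars_mom, entropyVars_four]
    field_simp
    ring
  have hwork : ∑ j, Q i (mom j) * stress g u Q i j
      = u 0 / pressure g u * ∑ j, velGrad g u Q i j * stress g u Q i j
        - Q i 4 * ∑ j, velocity u j * stress g u Q i j := by
    simp only [hmom, Finset.mul_sum, ← Finset.sum_sub_distrib]
    exact Finset.sum_congr rfl fun j _ => by ring
  simp only [sdot_eq_add_sum_mom_add, viscFlux_zero, viscFlux_mom, viscFlux_four, hwork, tempGrad]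
  ring

theorem sum_sdot_viscFlux_nonneg (hg : g.Valid) (hu : Admissible g u) (Q : BlockVec) :
    0 ≤ ∑ i, sdot (Q i) (viscFlux g u Q i) := by
  have hρ := hu.1
  have hp := hu.2
  have hμ := hg.μ_pos u hu
  have hγ : 0 < g.γ := one_pos.trans hg.one_lt_γ
  have hκ : 0 ≤ conductivity g u :=
    div_nonneg hμ.le (mul_nonneg (mul_nonneg (sub_pos.2 hg.one_lt_γ).le hg.prandtl_pos.le)
      (sq_nonneg _))
  simp only [sdot_viscFlux hu, Finset.sum_add_distrib, ← Finset.mul_sum, sum_velGrad_mul_stress]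
  positivity

end ViscousFluxes

/-! ### Interfaces -/

section SurfaceFlux

variable {g : Gas} {Fec : State → State → BlockVec} {uL uR : State}

lemma surfaceFlux_swap (hFec : IsEntropyConservative g Fec) (hL : Admissible g uL)
    (hR : Admissible g uR) (lam : ℝ) (n : Fin 3 → ℝ) :
    surfaceFlux g Fec lam (-n) uR uL = -surfaceFlux g Fec lam n uL uR := by
  rw [surfaceFlux, surfaceFlux, hFec.symm uR uL hR hL, ndot_neg,
    ← neg_sub (entropyVars g uR), smul_neg]
  abel

lemma sdot_jump_surfaceFlux (hFec : IsEntropyConservative g Fec) (hL : Admissible g uL)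
    (hR : Admissible g uR) (lam : ℝ) (n : Fin 3 → ℝ) :
    sdot (entropyVars g uR - entropyVars g uL) (surfaceFlux g Fec lam n uL uR)
      = ∑ i, n i * (entropyPotential g uR i - entropyPotential g uL i)
        - lam / 2 * sdot (entropyVars g uR - entropyVars g uL)
            (entropyVars g uR - entropyVars g uL) := by
  have htadmor : sdot (entropyVars g uR - entropyVars g uL) (ndot (Fec uL uR) n)
      = ∑ i, n i * (entropyPotential g uR i - entropyPotential g uL i) := by
    simp only [sdot_ndot, hFec.tadmor uL uR hL hR, entropyPotential]
  rw [← htadmor, surfaceFlux]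
  simp only [sdot_eq_dotProduct, dotProduct_sub, dotProduct_smul, smul_eq_mul]

end SurfaceFlux

section Faces

variable {N : ℕ} {x : Fin (N + 1) → ℝ} {K Fi Fb : Type*}

lemma SquareSymm.act_apply (σ : SquareSymm) (q : FaceNode N) (e : Fin 2) :
    σ.act q e = if σ.flip e then (q (σ.perm.symm e)).rev else q (σ.perm.symm e) := by
  cases hflip : σ.flip e <;> simp [act, hflip]

lemma IsGaussLobatto.surfWeight_act (hx : IsGaussLobatto N x) (σ : SquareSymm) (q : FaceNode N) :
    surfWeight x (σ.act q) = surfWeight x q := by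
  have hnode (e : Fin 2) : weight x (σ.act q e) = weight x (q (σ.perm.symm e)) := by
    rw [σ.act_apply, apply_ite (weight x), hx.weight_rev, ite_self]
  simp only [surfWeight, hnode]
  exact Equiv.prod_comp σ.perm.symm fun e => weight x (q e)

section Across

variable (m : Mesh N K Fi Fb)

lemma Mesh.across_left (f : Fi) (q : FaceNode N) :
    m.across (m.left f) q
      = .inl (f, q, (m.right f).1, (m.right f).2.node ((m.glue f).act q)) := by
  simp only [across, left, Equiv.symm_apply_apply]

lemma Mesh.across_right (f : Fi) (q : FaceNode N) :
    m.across (m.right f) ((m.glue f).act q)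
      = .inl (f, q, (m.left f).1, (m.left f).2.node q) := by
  simp only [across, right, Equiv.symm_apply_apply]

lemma Mesh.across_bdry (b : Fb) (q : FaceNode N) : m.across (m.bdry b) q = .inr b := by
  simp only [across, bdry, Equiv.symm_apply_apply]

end Across

lemma sum_surfInt [Fintype K] [Fintype Fi] [Fintype Fb] (hx : IsGaussLobatto N x)
    {m : Mesh N K Fi Fb} (hconf : m.Conforming) (G : K × LocalFace → FaceNode N → ℝ) :
    ∑ k, surfInt m x k (fun φ => G (k, φ))
      = ∑ f, faceInt m x (m.left f)
            (fun q => G (m.left f) q + G (m.right f) ((m.glue f).act q))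
        + ∑ b, faceInt m x (m.bdry b) (G (m.bdry b)) := by
  have hright (f : Fi) : faceInt m x (m.right f) (G (m.right f))
      = faceInt m x (m.left f) (fun q => G (m.right f) ((m.glue f).act q)) := by
    rw [faceInt, ← (m.glue f).act.sum_comp]
    simp only [hx.surfWeight_act, (hconf f _).1]
    rfl
  have hsides (f : Fi) : faceInt m x (m.left f) (G (m.left f))
        + faceInt m x (m.right f) (G (m.right f))
      = faceInt m x (m.left f) (fun q => G (m.left f) q + G (m.right f) ((m.glue f).act q)) := by
    rw [hright]
    simp only [faceInt, mul_add, add_mul, Finset.sum_add_distrib]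
  have hall : ∑ k, surfInt m x k (fun φ => G (k, φ)) = ∑ kf, faceInt m x kf (G kf) :=
    Fintype.sum_prod_type' (fun k φ => faceInt m x (k, φ) (G (k, φ))) |>.symm
  rw [hall, ← m.faces.sum_comp, Fintype.sum_sum_type, Fintype.sum_sum_type,
    ← Finset.sum_add_distrib]
  exact congrArg (· + _) (Finset.sum_congr rfl fun f _ => hsides f)

namespace Snapshot

variable (z : Snapshot N K Fi Fb) (g : Gas) (Fec : State → State → BlockVec) (m : Mesh N K Fi Fb)

/-- Entropy which the advective terms produce at a point of an element face: the volume terms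
contribute the normal entropy flux, the surface terms the correction by the numerical flux. -/
noncomputable def advectiveFaceProduction (kf : K × LocalFace) (q : FaceNode N) : ℝ :=
  -z.entFluxN g m kf q - sdot (z.Wtr g kf q) (z.numF g Fec m kf q - z.Fn g m kf q)

/-- Entropy which the viscous terms produce at a point of an element face, up to the factor
`1 / Re`: the contributions of the numerical trace `W*` and of the viscous numerical flux. -/
noncomputable def viscousFaceProduction (kf : K × LocalFace) (q : FaceNode N) : ℝ :=
  sdot (z.numW g m kf q) (z.Fvn g m kf q)
    + sdot (z.Wtr g kf q) (z.numFv g m kf q - z.Fvn g m kf q)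

variable {z g Fec m}

lemma advectiveFaceProduction_eq (kf : K × LocalFace) (q : FaceNode N) :
    z.advectiveFaceProduction g Fec m kf q
      = ∑ i, m.normal kf q i * entropyPotential g (z.Utr kf q) i
        - sdot (z.Wtr g kf q) (z.numF g Fec m kf q) := by
  have hflux : sdot (z.Wtr g kf q) (z.Fn g m kf q) - z.entFluxN g m kf q
      = ∑ i, m.normal kf q i * entropyPotential g (z.Utr kf q) i := by
    simp only [Fn, sdot_ndot, entFluxN, entropyPotential, mul_sub, Finset.sum_sub_distrib,
      mul_comm (entropyFlux g _ _)]
    rfl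
  rw [← hflux, advectiveFaceProduction, sdot_eq_dotProduct, dotProduct_sub]
  simp only [sdot_eq_dotProduct]
  ring

lemma advectiveFaceProduction_left_add_right (hFec : IsEntropyConservative g Fec)
    (hconf : m.Conforming) (hz : ∀ k I, Admissible g (z.U k I)) (f : Fi) (q : FaceNode N) :
    z.advectiveFaceProduction g Fec m (m.left f) q
        + z.advectiveFaceProduction g Fec m (m.right f) ((m.glue f).act q)
      = -(z.lam f q / 2 * sdot (z.jumpW g m f q) (z.jumpW g m f q)) := by
  have hL := hz (m.left f).1 ((m.left f).2.node q)
  have hR := hz (m.right f).1 ((m.right f).2.node ((m.glue f).act q))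
  have hflux := sdot_jump_surfaceFlux hFec hL hR (z.lam f q) (m.normal (m.left f) q)
  simp only [advectiveFaceProduction_eq, numF, m.across_left, m.across_right, (hconf f q).2, Utr,
    surfaceFlux_swap hFec hL hR, jumpW, Wtr, W]
  simp only [sdot_eq_dotProduct, sub_dotProduct, dotProduct_neg, Pi.neg_apply, mul_sub, neg_mul,
    Finset.sum_sub_distrib, Finset.sum_neg_distrib] at hflux ⊢
  linear_combination hflux

lemma viscousFaceProduction_left_add_right (hconf : m.Conforming) (f : Fi) (q : FaceNode N) :
    z.viscousFaceProduction g m (m.left f) q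
        + z.viscousFaceProduction g m (m.right f) ((m.glue f).act q) = 0 := by
  simp only [viscousFaceProduction, numW, numFv, m.across_left, m.across_right, Fvn, (hconf f q).2,
    ndot_neg, ndot_smul, ndot_add, Wtr]
  -- The product rule for jumps, `[[Wᵀ F]] = {{W}}ᵀ [[F]] + [[W]]ᵀ {{F}}`.
  simp only [sdot_eq_dotProduct, add_dotProduct, smul_dotProduct, dotProduct_sub, dotProduct_add,
    dotProduct_smul, dotProduct_neg, smul_eq_mul]
  ring

end Snapshot

end Faces

/-! ### The discrete entropy balance -/

section Balance

variable {N : ℕ} {x : Fin (N + 1) → ℝ} {K Fi Fb : Type*} {g : Gas}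
  {Fec : State → State → BlockVec} {m : Mesh N K Fi Fb}

lemma ipN_comm (x : Fin (N + 1) → ℝ) (F G : Node N → State) : ipN x F G = ipN x G F := by
  simp only [ipN, sdot_eq_dotProduct, dotProduct_comm]

lemma surfInt_add (m : Mesh N K Fi Fb) (x : Fin (N + 1) → ℝ) (k : K)
    (F G : LocalFace → FaceNode N → ℝ) :
    surfInt m x k (fun φ q => F φ q + G φ q) = surfInt m x k F + surfInt m x k G := by
  simp only [surfInt, faceInt, mul_add, add_mul, Finset.sum_add_distrib]

lemma surfInt_const_mul (m : Mesh N K Fi Fb) (x : Fin (N + 1) → ℝ) (k : K) (c : ℝ)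
    (F : LocalFace → FaceNode N → ℝ) :
    surfInt m x k (fun φ q => c * F φ q) = c * surfInt m x k F := by
  simp only [surfInt, faceInt, Finset.mul_sum, mul_left_comm _ c, mul_assoc]

namespace Snapshot

section Element

variable {z : Snapshot N K Fi Fb}

lemma ipN_stdDiv_entropyVars {k : K} (hgrad : z.GradEq g m x k (z.Fv g k)) :
    ipN x (m.stdDiv x k (z.Fv g k)) (z.W g k)
      = surfInt m x k (fun φ q => sdot (z.numW g m (k, φ) q) (z.Fvn g m (k, φ) q))
        - ∑ I, volWeight x I * ∑ i, sdot (m.J k I • z.Q k I i) (z.Fv g k I i) := by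
  rw [ipN_comm, hgrad]
  exact (sub_sub_cancel _ _).symm

theorem ipN_timeDeriv_entropyVars (hx : IsGaussLobatto N x)
    (hFec : IsEntropyConservative g Fec) (hmetric : m.MetricIdentities x) {k : K}
    (hz : ∀ I, Admissible g (z.U k I)) {Ut : Node N → State}
    (hsplit : z.SplitEq g Fec m x k Ut (z.W g k)) (hgrad : z.GradEq g m x k (z.Fv g k)) :
    ipN x (fun I => m.J k I • Ut I) (z.W g k)
      = surfInt m x k (fun φ q => z.advectiveFaceProduction g Fec m (k, φ) q
          + 1 / g.reynolds * z.viscousFaceProduction g m (k, φ) q)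
        - 1 / g.reynolds *
          ∑ I, volWeight x I * ∑ i, sdot (m.J k I • z.Q k I i) (z.Fv g k I i) := by
  have hvolume : ipN x (m.splitDiv x Fec k (z.U k)) (z.W g k)
      = surfInt m x k (fun φ => z.entFluxN g m (k, φ)) :=
    ipN_splitDiv_entropyVars hx hmetric hFec k hz
  have hadv : surfInt m x k (fun φ => z.advectiveFaceProduction g Fec m (k, φ))
      = -surfInt m x k (fun φ => z.entFluxN g m (k, φ))
        - surfInt m x k (fun φ q => sdot (z.W g k (φ.node q))
            (z.numF g Fec m (k, φ) q - z.Fn g m (k, φ) q)) := by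
    simp only [surfInt, faceInt, advectiveFaceProduction, Wtr, mul_sub, mul_neg, sub_mul, neg_mul,
      Finset.sum_sub_distrib, Finset.sum_neg_distrib]
  have hvisc : surfInt m x k (fun φ => z.viscousFaceProduction g m (k, φ))
      = surfInt m x k (fun φ q => sdot (z.numW g m (k, φ) q) (z.Fvn g m (k, φ) q))
        + surfInt m x k (fun φ q => sdot (z.W g k (φ.node q))
            (z.numFv g m (k, φ) q - z.Fvn g m (k, φ) q)) :=
    surfInt_add m x k _ _
  rw [surfInt_add, surfInt_const_mul, hadv, hvisc]
  rw [SplitEq, hvolume, ipN_stdDiv_entropyVars hgrad] at hsplit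
  linear_combination hsplit

end Element

lemma interfaceDissipation_nonneg {z : Snapshot N K Fi Fb} [Fintype Fi]
    (hlam : ∀ f q, 0 ≤ z.lam f q) : 0 ≤ z.interfaceDissipation g m x :=
  Finset.sum_nonneg fun f _ => Finset.sum_nonneg fun q _ =>
    mul_nonneg (mul_nonneg (surfWeight_nonneg x q)
      (mul_nonneg (div_nonneg (hlam f q) zero_le_two) (dotProduct_self_star_nonneg _)))
      (Real.sqrt_nonneg _)

lemma boundaryTerms_eq_boundaryTermsExt [Fintype Fb] {z : Snapshot N K Fi Fb}
    {lamB : Fb → FaceNode N → ℝ} {Uext : Fb → FaceNode N → State}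
    (h : ∀ b q, z.bd.Fstar b q =
      surfaceFlux g Fec (lamB b q) (m.normal (m.bdry b) q) (z.Utr (m.bdry b) q) (Uext b q)) :
    z.boundaryTerms g m x = z.boundaryTermsExt g Fec m x lamB Uext := by
  have hflux (b : Fb) (q : FaceNode N) :
      sdot (z.Wtr g (m.bdry b) q) (z.bd.Fstar b q - z.Fn g m (m.bdry b) q)
        = sdot (z.Wtr g (m.bdry b) q) (ndot (Fec (z.Utr (m.bdry b) q) (Uext b q))
            (m.normal (m.bdry b) q) - z.Fn g m (m.bdry b) q)
          - lamB b q / 2 * sdot (z.Wtr g (m.bdry b) q)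
              (entropyVars g (Uext b q) - z.Wtr g (m.bdry b) q) := by
    rw [h, surfaceFlux, sub_right_comm]
    simp only [sdot_eq_dotProduct]
    rw [dotProduct_sub, dotProduct_smul]
    rfl
  simp only [boundaryTerms, boundaryTermsExt, hflux, sub_add]

lemma faceProduction_bdry (z : Snapshot N K Fi Fb) (b : Fb) (q : FaceNode N) :
    z.advectiveFaceProduction g Fec m (m.bdry b) q
        + 1 / g.reynolds * z.viscousFaceProduction g m (m.bdry b) q
      = -z.entFluxN g m (m.bdry b) q
        + 1 / g.reynolds * sdot (z.Wtr g (m.bdry b) q) (z.Fvn g m (m.bdry b) q)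
        - sdot (z.Wtr g (m.bdry b) q) (z.bd.Fstar b q - z.Fn g m (m.bdry b) q)
        + 1 / g.reynolds *
          (sdot (z.bd.Wstar b q - z.Wtr g (m.bdry b) q) (z.Fvn g m (m.bdry b) q)
            + sdot (z.Wtr g (m.bdry b) q) (z.bd.Fvstar b q - z.Fvn g m (m.bdry b) q)) := by
  simp only [advectiveFaceProduction, viscousFaceProduction, numF, numW, numFv, m.across_bdry,
    sdot_eq_dotProduct, sub_dotProduct]
  ring

variable [Fintype K]

/-- Discrete entropy dissipated by the viscous fluxes inside the elements, `∑_k (J Q, F^v)_N`. -/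
noncomputable def viscousDissipation (z : Snapshot N K Fi Fb) (g : Gas) (m : Mesh N K Fi Fb)
    (x : Fin (N + 1) → ℝ) : ℝ :=
  ∑ k, ∑ I, volWeight x I * ∑ i, sdot (m.J k I • z.Q k I i) (z.Fv g k I i)

lemma viscousDissipation_nonneg {z : Snapshot N K Fi Fb} (hg : g.Valid)
    (hJ : ∀ k I, 0 ≤ m.J k I) (hz : ∀ k I, Admissible g (z.U k I)) :
    0 ≤ z.viscousDissipation g m x := by
  refine Finset.sum_nonneg fun k _ => Finset.sum_nonneg fun I _ =>
    mul_nonneg (volWeight_nonneg x I) ?_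
  simp only [sdot_eq_dotProduct, smul_dotProduct, ← Finset.smul_sum]
  exact smul_nonneg (hJ k I) (sum_sdot_viscFlux_nonneg hg (hz k I) _)

lemma sum_surfInt_faceProduction [Fintype Fi] [Fintype Fb] (hx : IsGaussLobatto N x)
    (hFec : IsEntropyConservative g Fec) (hconf : m.Conforming) {z : Snapshot N K Fi Fb}
    (hz : ∀ k I, Admissible g (z.U k I)) :
    ∑ k, surfInt m x k (fun φ q => z.advectiveFaceProduction g Fec m (k, φ) q
        + 1 / g.reynolds * z.viscousFaceProduction g m (k, φ) q)
      = z.boundaryTerms g m x - z.interfaceDissipation g m x := by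
  have hinterface (f : Fi) (q : FaceNode N) :
      z.advectiveFaceProduction g Fec m (m.left f) q
            + 1 / g.reynolds * z.viscousFaceProduction g m (m.left f) q
          + (z.advectiveFaceProduction g Fec m (m.right f) ((m.glue f).act q)
            + 1 / g.reynolds * z.viscousFaceProduction g m (m.right f) ((m.glue f).act q))
        = -(z.lam f q / 2 * sdot (z.jumpW g m f q) (z.jumpW g m f q)) := by
    linear_combination advectiveFaceProduction_left_add_right hFec hconf hz f q
      + 1 / g.reynolds * viscousFaceProduction_left_add_right (z := z) (g := g) hconf f q
  rw [sum_surfInt hx hconf fun kf q => z.advectiveFaceProduction g Fec m kf q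
    + 1 / g.reynolds * z.viscousFaceProduction g m kf q]
  simp only [hinterface, faceProduction_bdry, faceInt, mul_neg, neg_mul, Finset.sum_neg_distrib,
    boundaryTerms, interfaceDissipation]
  ring

theorem sum_ipN_timeDeriv_entropyVars [Fintype Fi] [Fintype Fb] (hx : IsGaussLobatto N x)
    (hFec : IsEntropyConservative g Fec) (hconf : m.Conforming)
    (hmetric : m.MetricIdentities x) {z : Snapshot N K Fi Fb}
    (hz : ∀ k I, Admissible g (z.U k I)) {Ut : K → Node N → State}
    (hsplit : ∀ k, z.SplitEq g Fec m x k (Ut k) (z.W g k))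
    (hgrad : ∀ k, z.GradEq g m x k (z.Fv g k)) :
    ∑ k, ipN x (fun I => m.J k I • Ut k I) (z.W g k)
      = z.boundaryTerms g m x - z.interfaceDissipation g m x
        - 1 / g.reynolds * z.viscousDissipation g m x := by
  rw [← sum_surfInt_faceProduction hx hFec hconf hz, viscousDissipation, Finset.mul_sum,
    ← Finset.sum_sub_distrib]
  exact Finset.sum_congr rfl fun k _ =>
    ipN_timeDeriv_entropyVars hx hFec hmetric (hz k) (hsplit k) (hgrad k)

lemma hasDerivWithinAt_totalEntropy (hγ : g.γ ≠ 1) (m : Mesh N K Fi Fb) (x : Fin (N + 1) → ℝ)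
    {z : ℝ → Snapshot N K Fi Fb} {Ut : K → Node N → State} {s : Set ℝ} {t : ℝ}
    (hz : ∀ k I, Admissible g ((z t).U k I))
    (hUt : ∀ k I, HasDerivWithinAt (fun τ => (z τ).U k I) (Ut k I) s t) :
    HasDerivWithinAt (fun τ => (z τ).totalEntropy g m x)
      (∑ k, ipN x (fun I => m.J k I • Ut k I) ((z t).W g k)) s t := by
  refine HasDerivWithinAt.fun_sum fun k _ => HasDerivWithinAt.fun_sum fun I _ => ?_
  refine (((hasDerivWithinAt_entropy hγ (hUt k I) (hz k I)).const_mul _).const_mul _).congr_deriv ?_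
  simp only [sdot_eq_dotProduct, smul_dotProduct, dotProduct_comm _ (Ut k I)]
  rfl

end Snapshot

end Balance

lemma antitoneOn_of_derivWithin_nonpos {D : Set ℝ} (hD : Convex ℝ D) {f : ℝ → ℝ}
    (hf : DifferentiableOn ℝ f D) (hf' : ∀ t ∈ interior D, derivWithin f D t ≤ 0) :
    AntitoneOn f D :=
  antitoneOn_of_hasDerivWithinAt_nonpos hD hf.continuousOn
    (fun t ht => ((hf t (interior_subset ht)).hasDerivWithinAt.mono interior_subset)) hf'

namespace IsSolution

variable {N : ℕ} {x : Fin (N + 1) → ℝ} {K Fi Fb : Type*} [Fintype K] {g : Gas}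
  {Fec : State → State → BlockVec} {m : Mesh N K Fi Fb} {T : ℝ} {z : ℝ → Snapshot N K Fi Fb}

lemma differentiableOn_totalEntropy (hz : IsSolution g Fec m x T z) (hγ : g.γ ≠ 1) :
    DifferentiableOn ℝ (fun t => (z t).totalEntropy g m x) (Set.Icc 0 T) := fun t ht =>
  let ⟨_, hUt, _⟩ := hz.split_eq t ht
  (Snapshot.hasDerivWithinAt_totalEntropy hγ m x (hz.admissible t ht) hUt).differentiableWithinAt

variable [Fintype Fi] [Fintype Fb]

theorem derivWithin_totalEntropy (hz : IsSolution g Fec m x T z) (hT : 0 < T)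
    (hx : IsGaussLobatto N x) (hγ : g.γ ≠ 1) (hFec : IsEntropyConservative g Fec)
    (hconf : m.Conforming) (hmetric : m.MetricIdentities x) {t : ℝ} (ht : t ∈ Set.Icc 0 T) :
    derivWithin (fun τ => (z τ).totalEntropy g m x) (Set.Icc 0 T) t
      = (z t).boundaryTerms g m x - (z t).interfaceDissipation g m x
        - 1 / g.reynolds * (z t).viscousDissipation g m x := by
  obtain ⟨Ut, hUt, hsplit⟩ := hz.split_eq t ht
  have ha := hz.admissible t ht
  rw [(Snapshot.hasDerivWithinAt_totalEntropy hγ m x ha hUt).derivWithin (uniqueDiffOn_Icc hT t ht)]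
  exact Snapshot.sum_ipN_timeDeriv_entropyVars hx hFec hconf hmetric ha (fun k => hsplit k _)
    (fun k => hz.grad_eq t ht k _)

theorem derivWithin_totalEntropy_le (hz : IsSolution g Fec m x T z) (hT : 0 < T)
    (hx : IsGaussLobatto N x) (hg : g.Valid) (hFec : IsEntropyConservative g Fec)
    (hconf : m.Conforming) (hmetric : m.MetricIdentities x) (hJ : ∀ k I, 0 ≤ m.J k I) {t : ℝ}
    (ht : t ∈ Set.Icc 0 T) :
    derivWithin (fun τ => (z τ).totalEntropy g m x) (Set.Icc 0 T) t
      ≤ (z t).boundaryTerms g m x - (z t).interfaceDissipation g m x := by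
  rw [hz.derivWithin_totalEntropy hT hx hg.one_lt_γ.ne' hFec hconf hmetric ht]
  exact sub_le_self _ (mul_nonneg (one_div_pos.2 hg.reynolds_pos).le
    (Snapshot.viscousDissipation_nonneg hg hJ (hz.admissible t ht)))

end IsSolution

end DGSEM

theorem mainTheorem1 {K Fi Fb : Type*} [Fintype K] [Fintype Fi] [Fintype Fb]
    (N : ℕ) (hN : 1 ≤ N) (x : Fin (N + 1) → ℝ) (hx : DGSEM.IsGaussLobatto N x)
    (g : DGSEM.Gas) (hg : g.Valid)
    (Fec : DGSEM.State → DGSEM.State → DGSEM.BlockVec)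
    (hFec : DGSEM.IsEntropyConservative g Fec)
    (m : DGSEM.Mesh N K Fi Fb) (hconf : m.Conforming) (hmetric : m.MetricIdentities x)
    (hJ : ∀ k I, 0 < m.J k I)
    (T : ℝ) (hT : 0 < T) (z : ℝ → DGSEM.Snapshot N K Fi Fb)
    (hz : DGSEM.IsSolution g Fec m x T z) :
    -- the total discrete entropy is differentiable in time and obeys the entropy estimate
    DifferentiableOn ℝ (fun t => (z t).totalEntropy g m x) (Set.Icc 0 T) ∧
    (∀ t ∈ Set.Icc 0 T,
      derivWithin (fun τ => (z τ).totalEntropy g m x) (Set.Icc 0 T) t ≤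
        (z t).boundaryTerms g m x - (z t).interfaceDissipation g m x) ∧
    -- the same with the advective boundary flux built from exterior states
    (∀ t ∈ Set.Icc 0 T, ∀ (lamB : Fb → DGSEM.FaceNode N → ℝ)
      (Uext : Fb → DGSEM.FaceNode N → DGSEM.State),
      (∀ b q, (z t).bd.Fstar b q =
        DGSEM.surfaceFlux g Fec (lamB b q) (m.normal (m.bdry b) q)
          ((z t).Utr (m.bdry b) q) (Uext b q)) →
      derivWithin (fun τ => (z τ).totalEntropy g m x) (Set.Icc 0 T) t ≤
        (z t).boundaryTermsExt g Fec m x lamB Uext - (z t).interfaceDissipation g m x) ∧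
    -- boundary data for which the physical boundary terms do not increase the entropy
    ((∀ t ∈ Set.Icc 0 T, (z t).boundaryTerms g m x ≤ 0) →
      (∀ t ∈ Set.Icc 0 T,
        derivWithin (fun τ => (z τ).totalEntropy g m x) (Set.Icc 0 T) t ≤ 0) ∧
      (z T).totalEntropy g m x ≤ (z 0).totalEntropy g m x) ∧
    -- periodic problems: there are no physical boundary faces
    (IsEmpty Fb →
      (∀ t ∈ Set.Icc 0 T,
        derivWithin (fun τ => (z τ).totalEntropy g m x) (Set.Icc 0 T) t ≤ 0) ∧
      (z T).totalEntropy g m x ≤ (z 0).totalEntropy g m x) := by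
  have hdiff := hz.differentiableOn_totalEntropy hg.one_lt_γ.ne'
  have hle (t : ℝ) (ht : t ∈ Set.Icc 0 T) :=
    hz.derivWithin_totalEntropy_le hT hx hg hFec hconf hmetric (fun k I => (hJ k I).le) ht
  have hstable (hPBT : ∀ t ∈ Set.Icc 0 T, (z t).boundaryTerms g m x ≤ 0) :
      (∀ t ∈ Set.Icc 0 T,
        derivWithin (fun τ => (z τ).totalEntropy g m x) (Set.Icc 0 T) t ≤ 0) ∧
      (z T).totalEntropy g m x ≤ (z 0).totalEntropy g m x := by
    have hnonpos (t : ℝ) (ht : t ∈ Set.Icc 0 T) := (hle t ht).trans <|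
      sub_nonpos.2 <| (hPBT t ht).trans <|
        DGSEM.Snapshot.interfaceDissipation_nonneg (hz.lam_nonneg t ht)
    have hanti := DGSEM.antitoneOn_of_derivWithin_nonpos (convex_Icc 0 T) hdiff
      fun t ht => hnonpos t (interior_subset ht)
    exact ⟨hnonpos, hanti (Set.left_mem_Icc.2 hT.le) (Set.right_mem_Icc.2 hT.le) hT.le⟩
  refine ⟨hdiff, hle, fun t ht lamB Uext h => ?_, hstable, fun _ => hstable fun t _ => ?_⟩
  · exact DGSEM.Snapshot.boundaryTerms_eq_boundaryTermsExt h ▸ hle t ht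
  · exact (Fintype.sum_empty _).le
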